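/- **Proposition.** Let $\omega$ be a non-principal ultrafilter on $\mathbb N$, let $(X_i,d_i,e_i)_{i\in\mathbb N}$ be pointed metric spaces, and let $p\in[1,\infty)$. Call a sequence $(x_i)\in\prod_i X_i$ limited if $d_i(x_i,e_i)\le C$ for $\omega$-almost all $i$, for some real $C$. Let $(\hat X,\hat d)$ be the metric ultralimit: the set of limited sequences modulo $\lim_\omega d_i(x_i,y_i)=0$, with $\hat d=\lim_\omega d_i$; write $st_{\hat d}[(x_i)]\in\hat X$ for the class of $(x_i)$. For a metric space $Y$, let $\mathcal P_p(Y)$ be the set of Radon probability measures on $Y$ with finite $p$-th moment, with the Wasserstein distance $W_p(\mu,\nu)=\inf_\gamma\big(\int d(x,y)^p\,d\gamma\big)^{1/p}$, the infimum being over all couplings $\gamma$ of $\mu$ and $\nu$; for a subset $S\subseteq Y$, measures in $\mathcal P_p(S)$ are regarded as measures on $Y$ by pushforward under the inclusion. Let $(\widehat{\mathcal P_p(X)},\hat W_p)$ be the metric ultralimit of the pointed spaces $(\mathcal P_p(X_i),W_p,\delta_{e_i})$, with classes written $st_{\hat W_p}[(\mu_i)]$. Let $F\subseteq\hat X$ be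 compact and let $F_i\subseteq X_i$ be such that every sequence with $x_i\in F_i$ for $\omega$-almost all $i$ is limited and $$st_{\hat d}(F^\omega):=\{st_{\hat d}[(x_i)] : x_i\in F_i \text{ for } \omega\text{-almost all } i\}=F .$$ Then: 1. The $F_i$ are $\omega$-a.s. uniformly totally bounded: there is a function $k:(0,\infty)\to\mathbb N$ such that for every $\varepsilon>0$, for $\omega$-almost all $i$, the set $F_i$ is covered by at most $k(\varepsilon)$ open balls of radius $\varepsilon$ with centres in $F_i$. 2. There is exactly one isometric embedding $\iota:(\mathcal P_p(\hat X),W_p)\to(\widehat{\mathcal P_p(X)},\hat W_p)$ such that $$\iota\Big(\tfrac1N\sum_{j=1}^N\delta_{st_{\hat d}[(x_{j,i})]}\Big)=st_{\hat W_p}\Big[\Big(\tfrac1N\sum_{j=1}^N\delta_{x_{j,i}}\Big)_i\Big]$$ for all $N\ge1$ and all limited sequences $(x_{1,i}),\dots,(x_{N,i})$, and it satisfies $$\iota(\mathcal P_p(F))=\{st_{\hat W_p}[(\mu_i)] : (\mu_i)\text{ limited},\ \mu_i\in\mathcal P_p(F_i)\text{ for }\omega\text{-almost all } i\}.$$ Moreover,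 this set is the metric ultralimit of the spaces $(\mathcal P_p(F_i),W_p)$: for any base points $f_i\in F_i$ ($i\in\mathbb N$), the inclusions $\mathcal P_p(F_i)\subseteq\mathcal P_p(X_i)$ induce a well-defined isometric embedding of the metric ultralimit of $(\mathcal P_p(F_i),W_p,\delta_{f_i})$ into $\widehat{\mathcal P_p(X)}$, whose image is $\iota(\mathcal P_p(F))$. -/

import Mathlib

open MeasureTheory Filter Topology
open scoped ENNReal

noncomputable section

/-! ### Metric ultralimits of pointed metric spaces -/

section Ultralimit

variable {X : ℕ → Type*} [∀ i, PseudoMetricSpace (X i)]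

/-- The point of the ultraproduct represented by `x` is at limited distance from the point
represented by the base points `e`. -/
def IsLimited (ω : Ultrafilter ℕ) (e x : ∀ i, X i) : Prop :=
  ∃ C : ℝ, ∀ᶠ i in (ω : Filter ℕ), dist (x i) (e i) ≤ C

variable (X) in
/-- Representatives of the limited part of the ultraproduct of the pointed spaces `(X i, e i)`.
Sequences that agree `ω`-almost surely are at distance zero (see the pseudometric below), so they
are identified in the ultralimit. -/
def LimitedSeq (ω : Ultrafilter ℕ) (e : ∀ i, X i) : Type _ :=
  {x : ∀ i, X i // IsLimited ω e x}

variable {ω : Ultrafilter ℕ} {e : ∀ i, X i}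

/-- The standard part of the hyperreal `[dist (x i) (y i)]`, as a limit along `ω`. -/
def stDist (x y : LimitedSeq X ω e) : ℝ :=
  limUnder (ω : Filter ℕ) (fun i => dist (x.1 i) (y.1 i))

theorem tendsto_stDist (x y : LimitedSeq X ω e) :
    Tendsto (fun i => dist (x.1 i) (y.1 i)) (ω : Filter ℕ) (𝓝 (stDist x y)) := by
  obtain ⟨C, hC⟩ := x.2
  obtain ⟨D, hD⟩ := y.2
  refine tendsto_nhds_limUnder ?_
  have hmem : ∀ᶠ i in (ω : Filter ℕ), dist (x.1 i) (y.1 i) ∈ Set.Icc 0 (C + D) := by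
    filter_upwards [hC, hD] with i h1 h2
    exact ⟨dist_nonneg, (dist_triangle_right _ _ (e i)).trans (add_le_add h1 h2)⟩
  have hle : ((ω.map (fun i => dist (x.1 i) (y.1 i)) : Ultrafilter ℝ) : Filter ℝ) ≤
      𝓟 (Set.Icc 0 (C + D)) := by
    rw [le_principal_iff]
    exact hmem
  obtain ⟨a, -, ha⟩ := (isCompact_Icc (a := (0 : ℝ)) (b := C + D)).ultrafilter_le_nhds _ hle
  exact ⟨a, ha⟩

instance : PseudoMetricSpace (LimitedSeq X ω e) where
  dist := stDist
  dist_self x := by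
    refine tendsto_nhds_unique (tendsto_stDist x x) ?_
    simp
  dist_comm x y := by
    refine tendsto_nhds_unique (tendsto_stDist x y) ?_
    simpa only [dist_comm] using tendsto_stDist y x
  dist_triangle x y z :=
    le_of_tendsto_of_tendsto' (tendsto_stDist x z)
      ((tendsto_stDist x y).add (tendsto_stDist y z)) (fun _ => dist_triangle _ _ _)

variable (X) in
/-- The metric ultralimit of the pointed spaces `(X i, e i)` along `ω`: limited sequences modulo
infinitesimal distance. -/
def Ultralimit (ω : Ultrafilter ℕ) (e : ∀ i, X i) : Type _ :=
  SeparationQuotient (LimitedSeq X ω e)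

instance : MetricSpace (Ultralimit X ω e) :=
  inferInstanceAs (MetricSpace (SeparationQuotient (LimitedSeq X ω e)))

instance : MeasurableSpace (Ultralimit X ω e) := borel _

instance : BorelSpace (Ultralimit X ω e) := ⟨rfl⟩

namespace Ultralimit

/-- The pushdown map: it sends a limited point of the ultraproduct to its class in the
ultralimit. -/
def st (x : LimitedSeq X ω e) : Ultralimit X ω e :=
  SeparationQuotient.mk x

theorem dist_st (x y : LimitedSeq X ω e) : dist (st x) (st y) = stDist x y := rfl

/-- The image, under the pushdown map, of the limited points of the internal set `[(S i)]`. -/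
def pushdown (S : ∀ i, Set (X i)) : Set (Ultralimit X ω e) :=
  st '' {x | ∀ᶠ i in (ω : Filter ℕ), x.1 i ∈ S i}

end Ultralimit

end Ultralimit

/-! ### Wasserstein spaces of Radon measures -/

section Wasserstein

/-- Radon probability measures on `X` with finite `p`-th moment. -/
structure WassersteinSpace (p : ℝ) (X : Type*) [PseudoMetricSpace X] [MeasurableSpace X] where
  toMeasure : Measure X
  isProbabilityMeasure : IsProbabilityMeasure toMeasure
  innerRegular : toMeasure.InnerRegular
  finite_moment : ∃ x₀ : X, ∫⁻ x, edist x x₀ ^ p ∂toMeasure < ∞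

/-- `γ` is a coupling of `μ` and `ν`. -/
structure IsCoupling {X : Type*} [MeasurableSpace X] (μ ν : Measure X) (γ : Measure (X × X)) :
    Prop where
  map_fst : γ.map Prod.fst = μ
  map_snd : γ.map Prod.snd = ν

variable {p : ℝ} {X : Type*} [PseudoMetricSpace X] [MeasurableSpace X]

/-- The `p`-transport cost of a plan `γ`. For a coupling of Radon measures the distance is
`γ`-almost everywhere measurable, even if `X` is not separable: see `IsCoupling.aemeasurable_edist`
below. -/
def transportCost (p : ℝ) (γ : Measure (X × X)) : ℝ≥0∞ :=
  (∫⁻ z, edist z.1 z.2 ^ p ∂γ) ^ (1 / p)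

/-- The `p`-Wasserstein distance. -/
def wassersteinEDist (p : ℝ) (μ ν : Measure X) : ℝ≥0∞ :=
  ⨅ (γ : Measure (X × X)) (_ : IsCoupling μ ν γ), transportCost p γ

theorem exists_separable_carrier [OpensMeasurableSpace X] (μ : Measure X) [IsProbabilityMeasure μ]
    [μ.InnerRegular] : ∃ S : Set X, TopologicalSpace.IsSeparable S ∧ ∀ᵐ x ∂μ, x ∈ S := by
  have h : ∀ n : ℕ, ∃ K : Set X, IsCompact K ∧ μ Kᶜ ≤ ((n : ℝ≥0∞) + 1)⁻¹ := by
    intro n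
    obtain ⟨K, -, hK, hlt⟩ := MeasurableSet.univ.exists_isCompact_lt_add (μ := μ)
      (measure_ne_top _ _) (ε := ((n : ℝ≥0∞) + 1)⁻¹) (by simp)
    refine ⟨closure K, hK.closure, ?_⟩
    rw [prob_compl_eq_one_sub isClosed_closure.measurableSet]
    rw [measure_univ] at hlt
    exact tsub_le_iff_left.2 (hlt.le.trans (add_le_add_left (measure_mono subset_closure) _))
  choose K hK hμ using h
  refine ⟨⋃ n, K n, TopologicalSpace.IsSeparable.iUnion fun n => (hK n).isSeparable, ?_⟩
  change μ (⋃ n, K n)ᶜ = 0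
  have hle : ∀ n : ℕ, μ (⋃ n, K n)ᶜ ≤ ((n : ℝ≥0∞) + 1)⁻¹ := fun n =>
    (measure_mono (Set.compl_subset_compl.2 (Set.subset_iUnion K n))).trans (hμ n)
  have ht : Tendsto (fun n : ℕ => ((n : ℝ≥0∞) + 1)⁻¹) atTop (𝓝 0) := by
    have := (tendsto_add_atTop_iff_nat 1).2 ENNReal.tendsto_inv_nat_nhds_zero
    simpa using this
  exact le_antisymm (ge_of_tendsto' ht hle) bot_le

theorem IsCoupling.aemeasurable_edist [OpensMeasurableSpace X] {μ ν : Measure X}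
    [IsProbabilityMeasure μ] [μ.InnerRegular] {γ : Measure (X × X)} (h : IsCoupling μ ν γ) :
    AEMeasurable (fun z : X × X => edist z.1 z.2) γ := by
  obtain ⟨S, ⟨c, hc, hSc⟩, hS⟩ := exists_separable_carrier μ
  refine ⟨fun z => ⨅ x ∈ c, (edist z.1 x + edist x z.2), ?_, ?_⟩
  · refine Measurable.biInf c hc fun x _ => ?_
    exact ((measurable_edist_left).comp measurable_fst).add
      ((measurable_edist_right).comp measurable_snd)
  · rw [← h.map_fst] at hS
    filter_upwards [ae_of_ae_map measurable_fst.aemeasurable hS] with z hz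
    refine le_antisymm (le_iInf₂ fun x _ => edist_triangle _ _ _) ?_
    refine ENNReal.le_of_forall_pos_le_add fun ε hε _ => ?_
    obtain ⟨x, hx, hlt⟩ := EMetric.mem_closure_iff.1 (hSc hz) ((ε : ℝ≥0∞) / 2)
      (ENNReal.half_pos (by exact_mod_cast hε.ne'))
    refine (iInf₂_le x hx).trans ?_
    calc edist z.1 x + edist x z.2
        ≤ edist z.1 x + (edist z.1 x + edist z.1 z.2) :=
          add_le_add_right (edist_triangle_left _ _ _) _
      _ ≤ (ε : ℝ≥0∞) / 2 + ((ε : ℝ≥0∞) / 2 + edist z.1 z.2) := by gcongr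
      _ = edist z.1 z.2 + ε := by
          rw [← add_assoc, ENNReal.add_halves, add_comm]

theorem exists_small_partition [OpensMeasurableSpace X] (μ : Measure X) [IsProbabilityMeasure μ]
    [μ.InnerRegular] {ε : ℝ≥0∞} (hε : 0 < ε) :
    ∃ B : ℕ → Set X, (∀ n, MeasurableSet (B n)) ∧ Pairwise (Function.onFun Disjoint B) ∧
      (∀ᵐ x ∂μ, x ∈ ⋃ n, B n) ∧ ∀ n, ∀ x ∈ B n, ∀ y ∈ B n, edist x y ≤ ε := by
  obtain ⟨S, ⟨c, hc, hSc⟩, hS⟩ := exists_separable_carrier μ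
  obtain ⟨x₁, hx₁⟩ : S.Nonempty := hS.exists
  have hcne : c.Nonempty := closure_nonempty_iff.1 ⟨x₁, hSc hx₁⟩
  obtain ⟨s, rfl⟩ := hc.exists_eq_range hcne
  let A : ℕ → Set X := fun n => {x | edist x (s n) < ε / 2}
  have hA : ∀ n, MeasurableSet (A n) := fun n =>
    measurableSet_lt measurable_edist_left measurable_const
  refine ⟨disjointed A, MeasurableSet.disjointed hA, disjoint_disjointed A, ?_, ?_⟩
  · filter_upwards [hS] with x hx
    rw [iUnion_disjointed]
    obtain ⟨_, ⟨n, rfl⟩, hlt⟩ := EMetric.mem_closure_iff.1 (hSc hx) (ε / 2)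
      (ENNReal.half_pos hε.ne')
    exact Set.mem_iUnion.2 ⟨n, hlt⟩
  · intro n x hx y hy
    have h1 : edist x (s n) < ε / 2 := disjointed_subset A n hx
    have h2 : edist y (s n) < ε / 2 := disjointed_subset A n hy
    calc edist x y ≤ edist x (s n) + edist y (s n) := edist_triangle_right _ _ _
      _ ≤ ε / 2 + ε / 2 := add_le_add h1.le h2.le
      _ = ε := ENNReal.add_halves ε

theorem IsCoupling.isProbabilityMeasure {X : Type*} [MeasurableSpace X] {μ ν : Measure X} [IsProbabilityMeasure μ]
    {γ : Measure (X × X)} (h : IsCoupling μ ν γ) : IsProbabilityMeasure γ := by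
  refine ⟨?_⟩
  have h1 : γ.map Prod.fst Set.univ = 1 := by rw [h.map_fst]; exact measure_univ
  rwa [Measure.map_apply measurable_fst MeasurableSet.univ, Set.preimage_univ] at h1

/-- Approximate gluing of two couplings along their common marginal. -/
theorem exists_approx_gluing [OpensMeasurableSpace X] {μ ν ρ : Measure X}
    [IsProbabilityMeasure μ] [IsProbabilityMeasure ν] [ν.InnerRegular]
    {γ₁ γ₂ : Measure (X × X)} (h₁ : IsCoupling μ ν γ₁) (h₂ : IsCoupling ν ρ γ₂)
    {ε : ℝ≥0∞} (hε : 0 < ε) :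
    ∃ G : Measure ((X × X) × (X × X)), G.map Prod.fst = γ₁ ∧ G.map Prod.snd = γ₂ ∧
      ∀ᵐ w ∂G, edist w.1.2 w.2.1 ≤ ε := by
  obtain ⟨B, hBm, hBd, hBc, hBs⟩ := exists_small_partition ν hε
  have := h₁.isProbabilityMeasure
  have := h₂.isProbabilityMeasure
  let P : ℕ → Measure (X × X) := fun n => γ₁.restrict (Prod.snd ⁻¹' B n)
  let Q : ℕ → Measure (X × X) := fun n => γ₂.restrict (Prod.fst ⁻¹' B n)
  have hP : ∀ n, P n Set.univ = ν (B n) := fun n => by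
    rw [Measure.restrict_apply_univ, ← h₁.map_snd, Measure.map_apply measurable_snd (hBm n)]
  have hQ : ∀ n, Q n Set.univ = ν (B n) := fun n => by
    rw [Measure.restrict_apply_univ, ← h₂.map_fst, Measure.map_apply measurable_fst (hBm n)]
  have hPsum : Measure.sum P = γ₁ := by
    have hae : ∀ᵐ z ∂γ₁, z ∈ ⋃ n, Prod.snd ⁻¹' B n := by
      rw [← h₁.map_snd] at hBc
      filter_upwards [ae_of_ae_map measurable_snd.aemeasurable hBc] with z hz
      simpa using hz
    rw [← Measure.restrict_iUnion (fun i j hij => (hBd hij).preimage _)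
      (fun n => measurable_snd (hBm n))]
    exact Measure.restrict_eq_self_of_ae_mem hae
  have hQsum : Measure.sum Q = γ₂ := by
    have hae : ∀ᵐ z ∂γ₂, z ∈ ⋃ n, Prod.fst ⁻¹' B n := by
      rw [← h₂.map_fst] at hBc
      filter_upwards [ae_of_ae_map measurable_fst.aemeasurable hBc] with z hz
      simpa using hz
    rw [← Measure.restrict_iUnion (fun i j hij => (hBd hij).preimage _)
      (fun n => measurable_fst (hBm n))]
    exact Measure.restrict_eq_self_of_ae_mem hae
  have hcancel : ∀ (n : ℕ) (R : Measure (X × X)), R Set.univ = ν (B n) →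
      (ν (B n))⁻¹ • (ν (B n) • R) = R := by
    intro n R hR
    rcases eq_or_ne (ν (B n)) 0 with h0 | h0
    · rw [h0, Measure.measure_univ_eq_zero] at hR
      simp [hR]
    · rw [smul_smul, ENNReal.inv_mul_cancel h0 (measure_ne_top _ _), one_smul]
  refine ⟨Measure.sum fun n => (ν (B n))⁻¹ • (P n).prod (Q n), ?_, ?_, ?_⟩
  · rw [Measure.map_sum measurable_fst.aemeasurable]
    rw [← hPsum]
    congr 1
    funext n
    rw [Measure.map_smul, Measure.map_fst_prod, hQ n, hcancel n _ (hP n)]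
  · rw [Measure.map_sum measurable_snd.aemeasurable]
    rw [← hQsum]
    congr 1
    funext n
    rw [Measure.map_smul, Measure.map_snd_prod, hP n, hcancel n _ (hQ n)]
  · rw [Measure.ae_sum_iff]
    intro n
    refine Measure.ae_smul_measure ?_ _
    have hp : ∀ᵐ w ∂(P n).prod (Q n), w.1.2 ∈ B n :=
      Measure.quasiMeasurePreserving_fst.ae
        (ae_restrict_mem (measurable_snd (hBm n)) : ∀ᵐ z ∂P n, z.2 ∈ B n)
    have hq : ∀ᵐ w ∂(P n).prod (Q n), w.2.1 ∈ B n :=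
      Measure.quasiMeasurePreserving_snd.ae
        (ae_restrict_mem (measurable_fst (hBm n)) : ∀ᵐ z ∂Q n, z.1 ∈ B n)
    filter_upwards [hp, hq] with w h1 h2
    exact hBs n _ h1 _ h2

theorem wassersteinEDist_triangle [OpensMeasurableSpace X] (hp : 1 ≤ p) {μ ν ρ : Measure X}
    [IsProbabilityMeasure μ] [μ.InnerRegular] [IsProbabilityMeasure ν] [ν.InnerRegular] :
    wassersteinEDist p μ ρ ≤ wassersteinEDist p μ ν + wassersteinEDist p ν ρ := by
  have hp0 : 0 < p := zero_lt_one.trans_le hp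
  have key : ∀ (γ₁ γ₂ : Measure (X × X)), IsCoupling μ ν γ₁ → IsCoupling ν ρ γ₂ →
      wassersteinEDist p μ ρ ≤ transportCost p γ₁ + transportCost p γ₂ := by
    intro γ₁ γ₂ h₁ h₂
    refine ENNReal.le_of_forall_pos_le_add fun ε hε _ => ?_
    obtain ⟨G, hG₁, hG₂, hG⟩ := exists_approx_gluing h₁ h₂
      (ε := (ε : ℝ≥0∞)) (by exact_mod_cast hε)
    have := h₁.isProbabilityMeasure
    have hGp : IsProbabilityMeasure G := by
      refine ⟨?_⟩
      have h1 : G.map Prod.fst Set.univ = 1 := by rw [hG₁]; exact measure_univ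
      rwa [Measure.map_apply measurable_fst MeasurableSet.univ, Set.preimage_univ] at h1
    have hm : Measurable fun w : (X × X) × (X × X) => (w.1.1, w.2.2) :=
      (measurable_fst.comp measurable_fst).prodMk (measurable_snd.comp measurable_snd)
    have hc : IsCoupling μ ρ (G.map fun w => (w.1.1, w.2.2)) := by
      constructor
      · rw [Measure.map_map measurable_fst hm, ← h₁.map_fst, ← hG₁,
          Measure.map_map measurable_fst measurable_fst]
        rfl
      · rw [Measure.map_map measurable_snd hm, ← h₂.map_snd, ← hG₂,
          Measure.map_map measurable_snd measurable_snd]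
        rfl
    let f : (X × X) × (X × X) → ℝ≥0∞ := fun w => edist w.1.1 w.1.2
    let g : (X × X) × (X × X) → ℝ≥0∞ := fun w => edist w.2.1 w.2.2
    let h : (X × X) × (X × X) → ℝ≥0∞ := fun _ => (ε : ℝ≥0∞)
    have hf : AEMeasurable f G := by
      have := h₁.aemeasurable_edist
      rw [← hG₁] at this
      exact this.comp_measurable measurable_fst
    have hg : AEMeasurable g G := by
      have := h₂.aemeasurable_edist
      rw [← hG₂] at this
      exact this.comp_measurable measurable_snd
    have hfc : (∫⁻ w, f w ^ p ∂G) ^ (1 / p) = transportCost p γ₁ := by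
      have := h₁.aemeasurable_edist
      rw [← hG₁] at this
      rw [transportCost, ← hG₁, lintegral_map' (this.pow_const p) measurable_fst.aemeasurable]
    have hgc : (∫⁻ w, g w ^ p ∂G) ^ (1 / p) = transportCost p γ₂ := by
      have := h₂.aemeasurable_edist
      rw [← hG₂] at this
      rw [transportCost, ← hG₂, lintegral_map' (this.pow_const p) measurable_snd.aemeasurable]
    calc wassersteinEDist p μ ρ
        ≤ transportCost p (G.map fun w => (w.1.1, w.2.2)) := iInf₂_le _ hc
      _ ≤ (∫⁻ w, edist w.1.1 w.2.2 ^ p ∂G) ^ (1 / p) := by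
          unfold transportCost
          gcongr
          exact lintegral_map_le _ _
      _ ≤ (∫⁻ w, ((f + g) + h) w ^ p ∂G) ^ (1 / p) := by
          gcongr 1
          refine lintegral_mono_ae ?_
          filter_upwards [hG] with w hw
          gcongr
          calc edist w.1.1 w.2.2 ≤ edist w.1.1 w.1.2 + edist w.1.2 w.2.1 + edist w.2.1 w.2.2 :=
                edist_triangle4 _ _ _ _
            _ ≤ edist w.1.1 w.1.2 + ε + edist w.2.1 w.2.2 := by gcongr
            _ = ((f + g) + h) w := by
                simp only [Pi.add_apply, f, g, h]
                ring
      _ ≤ (∫⁻ w, (f + g) w ^ p ∂G) ^ (1 / p) + (∫⁻ _, (ε : ℝ≥0∞) ^ p ∂G) ^ (1 / p) :=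
          ENNReal.lintegral_Lp_add_le (hf.add hg) aemeasurable_const hp
      _ ≤ (transportCost p γ₁ + transportCost p γ₂) + ε := by
          refine add_le_add ?_ ?_
          · rw [← hfc, ← hgc]
            exact ENNReal.lintegral_Lp_add_le hf hg hp
          · rw [lintegral_const, measure_univ, mul_one, ← ENNReal.rpow_mul,
              mul_one_div_cancel hp0.ne', ENNReal.rpow_one]
  unfold wassersteinEDist at key ⊢
  simp only [ENNReal.iInf_add, ENNReal.add_iInf]
  exact le_iInf₂ fun γ₂ h₂ => le_iInf₂ fun γ₁ h₁ => key γ₁ γ₂ h₁ h₂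

theorem wassersteinEDist_self [OpensMeasurableSpace X] (hp : 0 < p) (μ : Measure X) :
    wassersteinEDist p μ μ = 0 := by
  have hm : Measurable fun x : X => (x, x) := measurable_id.prodMk measurable_id
  have hc : IsCoupling μ μ (μ.map fun x => (x, x)) :=
    ⟨by rw [Measure.map_map measurable_fst hm]; exact Measure.map_id (μ := μ),
      by rw [Measure.map_map measurable_snd hm]; exact Measure.map_id (μ := μ)⟩
  refine le_antisymm ((iInf₂_le _ hc).trans ?_) bot_le
  have h0 : ∫⁻ z, edist z.1 z.2 ^ p ∂(μ.map fun x => (x, x)) = 0 := by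
    refine le_antisymm ((lintegral_map_le _ _).trans ?_) bot_le
    simp [hp]
  rw [transportCost, h0, ENNReal.zero_rpow_of_pos (by positivity)]

theorem wassersteinEDist_comm_le [OpensMeasurableSpace X] (hp : 0 < p) (μ ν : Measure X) :
    wassersteinEDist p μ ν ≤ wassersteinEDist p ν μ := by
  refine le_iInf₂ fun γ h => ?_
  have hc : IsCoupling μ ν (γ.map Prod.swap) :=
    ⟨by rw [Measure.map_map measurable_fst (measurable_swap (α := X) (β := X))]; exact h.map_snd,
      by rw [Measure.map_map measurable_snd (measurable_swap (α := X) (β := X))]; exact h.map_fst⟩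
  refine (iInf₂_le _ hc).trans ?_
  refine ENNReal.rpow_le_rpow ?_ (by positivity)
  refine (lintegral_map_le _ _).trans (le_of_eq ?_)
  exact lintegral_congr fun z => by rw [Prod.fst_swap, Prod.snd_swap, edist_comm]

theorem wassersteinEDist_dirac_le [OpensMeasurableSpace X] (hp : 0 < p) (μ : Measure X)
    [IsProbabilityMeasure μ] (y : X) :
    wassersteinEDist p μ (Measure.dirac y) ≤ (∫⁻ x, edist x y ^ p ∂μ) ^ (1 / p) := by
  have hm : Measurable fun x : X => (x, y) := measurable_id.prodMk measurable_const
  have hc : IsCoupling μ (Measure.dirac y) (μ.map fun x => (x, y)) :=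
    ⟨by rw [Measure.map_map measurable_fst hm]; exact Measure.map_id,
      by
        rw [Measure.map_map measurable_snd hm]
        change μ.map (fun _ => y) = _
        rw [Measure.map_const, measure_univ, one_smul]⟩
  refine (iInf₂_le _ hc).trans ?_
  unfold transportCost
  gcongr
  exact lintegral_map_le _ _

instance innerRegular_dirac [OpensMeasurableSpace X] (x : X) :
    (Measure.dirac x).InnerRegular := by
  refine ⟨fun A hA r hr => ?_⟩
  rw [Measure.dirac_apply' x hA] at hr
  by_cases hx : x ∈ A
  · refine ⟨{x}, by simpa using hx, isCompact_singleton, ?_⟩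
    rw [Set.indicator_of_mem hx] at hr
    refine hr.trans_le ?_
    rw [Measure.dirac_apply_of_mem (Set.mem_singleton x)]
    rfl
  · simp [hx] at hr

namespace WassersteinSpace

attribute [instance] WassersteinSpace.isProbabilityMeasure WassersteinSpace.innerRegular

variable [OpensMeasurableSpace X]

instance [Fact (1 ≤ p)] : PseudoEMetricSpace (WassersteinSpace p X) where
  edist μ ν := wassersteinEDist p μ.toMeasure ν.toMeasure
  edist_self μ := wassersteinEDist_self (zero_lt_one.trans_le Fact.out) _
  edist_comm μ ν := le_antisymm (wassersteinEDist_comm_le (zero_lt_one.trans_le Fact.out) _ _)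
    (wassersteinEDist_comm_le (zero_lt_one.trans_le Fact.out) _ _)
  edist_triangle _ _ _ := wassersteinEDist_triangle Fact.out

theorem edist_def [Fact (1 ≤ p)] (μ ν : WassersteinSpace p X) :
    edist μ ν = wassersteinEDist p μ.toMeasure ν.toMeasure := rfl

/-- The uniform discrete measure `(1 / N) ∑ j, δ_{x j}`. -/
def diracCloud (p : ℝ) [Fact (1 ≤ p)] (N : ℕ) [NeZero N] (x : Fin N → X) :
    WassersteinSpace p X where
  toMeasure := (N : ℝ≥0∞)⁻¹ • ∑ j, Measure.dirac (x j)
  isProbabilityMeasure := by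
    refine ⟨?_⟩
    simp [ENNReal.inv_mul_cancel (Nat.cast_ne_zero.2 (NeZero.ne N)) (ENNReal.natCast_ne_top N)]
  innerRegular := inferInstance
  finite_moment := by
    refine ⟨x 0, ?_⟩
    rw [lintegral_smul_measure, lintegral_finsetSum_measure]
    refine ENNReal.mul_lt_top (by simp [NeZero.pos N]) (ENNReal.sum_lt_top.2 fun j _ => ?_)
    rw [lintegral_dirac' _ (measurable_edist_left.pow_const p)]
    exact ENNReal.rpow_lt_top_of_nonneg (zero_le_one.trans Fact.out) (edist_ne_top _ _)

/-- The Dirac mass at `x`. -/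
def dirac (p : ℝ) [Fact (1 ≤ p)] (x : X) : WassersteinSpace p X where
  toMeasure := Measure.dirac x
  isProbabilityMeasure := inferInstance
  innerRegular := inferInstance
  finite_moment := by
    refine ⟨x, ?_⟩
    rw [lintegral_dirac' _ (measurable_edist_left.pow_const p)]
    exact ENNReal.rpow_lt_top_of_nonneg (zero_le_one.trans Fact.out) (edist_ne_top _ _)

theorem edist_dirac_dirac_ne_top [hp : Fact (1 ≤ p)] (x y : X) :
    edist (dirac p x) (dirac p y) ≠ ∞ := by
  have hp0 : 0 < p := zero_lt_one.trans_le hp.out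
  refine ne_top_of_le_ne_top ?_ (wassersteinEDist_dirac_le hp0 _ y)
  change (∫⁻ z, edist z y ^ p ∂(Measure.dirac x)) ^ (1 / p) ≠ ∞
  rw [lintegral_dirac' _ (measurable_edist_left.pow_const p)]
  exact ENNReal.rpow_ne_top_of_nonneg (by positivity)
    (ENNReal.rpow_ne_top_of_nonneg hp0.le (edist_ne_top _ _))

theorem edist_ne_top' [hp : Fact (1 ≤ p)] (μ ν : WassersteinSpace p X) : edist μ ν ≠ ∞ := by
  have hp0 : 0 < p := zero_lt_one.trans_le hp.out
  obtain ⟨x, hx⟩ := μ.finite_moment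
  obtain ⟨y, hy⟩ := ν.finite_moment
  have h1 : edist μ (dirac p x) ≠ ∞ := ne_top_of_le_ne_top
    (ENNReal.rpow_ne_top_of_nonneg (by positivity) hx.ne) (wassersteinEDist_dirac_le hp0 _ x)
  have h2 : edist ν (dirac p y) ≠ ∞ := ne_top_of_le_ne_top
    (ENNReal.rpow_ne_top_of_nonneg (by positivity) hy.ne) (wassersteinEDist_dirac_le hp0 _ y)
  rw [edist_comm] at h2
  exact ne_top_of_le_ne_top
    (ENNReal.add_ne_top.2 ⟨ENNReal.add_ne_top.2 ⟨h1, edist_dirac_dirac_ne_top x y⟩, h2⟩)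
    (edist_triangle4 μ (dirac p x) (dirac p y) ν)

/-- The `p`-Wasserstein space with its distance `W_p`. -/
instance [Fact (1 ≤ p)] : PseudoMetricSpace (WassersteinSpace p X) :=
  PseudoEMetricSpace.toPseudoMetricSpace edist_ne_top'

theorem dist_def [Fact (1 ≤ p)] (μ ν : WassersteinSpace p X) :
    dist μ ν = (wassersteinEDist p μ.toMeasure ν.toMeasure).toReal := rfl

/-- A measure on the subspace `S`, regarded as a measure on `X` (pushforward under the
inclusion). -/
def ofSubspace {X : Type*} [PseudoMetricSpace X] [MeasurableSpace X] [BorelSpace X] (S : Set X)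
    (μ : WassersteinSpace p S) : WassersteinSpace p X where
  toMeasure := μ.toMeasure.map Subtype.val
  isProbabilityMeasure := Measure.isProbabilityMeasure_map measurable_subtype_coe.aemeasurable
  innerRegular := Measure.InnerRegular.map_of_continuous continuous_subtype_val
  finite_moment := by
    obtain ⟨x₀, h⟩ := μ.finite_moment
    exact ⟨x₀, (lintegral_map_le _ _).trans_lt h⟩

/-- `P_p(S)`, as a subset of `P_p(X)`. -/
def supportedOn {X : Type*} [PseudoMetricSpace X] [MeasurableSpace X] [BorelSpace X]
    (p : ℝ) (S : Set X) : Set (WassersteinSpace p X) :=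
  Set.range (ofSubspace (p := p) S)

end WassersteinSpace

end Wasserstein

/-! ### The canonical embedding -/

section Embedding

variable {X : ℕ → Type*} [∀ i, MetricSpace (X i)] [∀ i, MeasurableSpace (X i)]
  [∀ i, BorelSpace (X i)]

/-- The metric ultralimit of the pointed Wasserstein spaces `(P_p(X i), W_p, δ_{e i})`. -/
abbrev WassersteinUltralimit (p : ℝ) [Fact (1 ≤ p)] (ω : Ultrafilter ℕ) (e : ∀ i, X i) : Type _ :=
  Ultralimit (fun i => WassersteinSpace p (X i)) ω (fun i => WassersteinSpace.dirac p (e i))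

/-- `ι : P_p(X̂) → P̂_p(X)` is an isometric embedding that sends every Dirac cloud
`(1 / N) ∑ j, δ_{st (x j)}` to the class of the sequence of clouds `(1 / N) ∑ j, δ_{x j i}`
(in particular this sequence is limited). -/
structure IsCanonicalEmbedding {p : ℝ} [Fact (1 ≤ p)] {ω : Ultrafilter ℕ} {e : ∀ i, X i}
    (ι : WassersteinSpace p (Ultralimit X ω e) → WassersteinUltralimit p ω e) : Prop where
  isometry : Isometry ι
  map_diracCloud : ∀ (N : ℕ) [NeZero N] (x : Fin N → LimitedSeq X ω e),
    ∃ h : IsLimited ω (fun i => WassersteinSpace.dirac p (e i))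
        (fun i => WassersteinSpace.diracCloud p N (fun j => (x j).1 i)),
      ι (WassersteinSpace.diracCloud p N (fun j => Ultralimit.st (x j))) = Ultralimit.st ⟨_, h⟩

end Embedding

end

/-! Everything reduces to Dirac clouds, that is, uniform measures on finite families of points. A
plan between two clouds is a matrix of masses, and the same matrix transports any other pair of
clouds of the same sizes. Hence $W_p$ between clouds depends only on the cross distances, and
raising these by at most $\varepsilon$ raises it by at most $\varepsilon$ (`dist_diracCloud_le`).
Finitely many distances converge along $\omega$ to the distances in $\hat X$, so the prescribed map
on clouds is isometric (`dist_stDiracCloud`). Clouds are dense in $\mathcal P_p(\hat X)$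
(`exists_dist_diracCloud_lt`) and ultralimits are complete by saturation (`isComplete_pushdown`), so
this map has exactly one isometric extension $\iota$.

Clouds in $F$ lift to clouds in the $F_i$, and pushdowns are closed; this puts $\iota(\mathcal
P_p(F))$ inside the pushdown of the $\mathcal P_p(F_i)$. For the converse, a sequence of clouds is a
tuple of sequences of points only if the number of points does not depend on $i$. Such a uniform
size comes from the uniform total boundedness of the $F_i$ (`exists_finset_cover`,
`exists_size_diracCloud_approx`): a lifted finite net of $F$ must be a net of almost all $F_i$,
since otherwise the uncovered points would define a point of $F$ missed by the net. The limit of the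
approximating clouds stays in $\iota(\mathcal P_p(F))$ because $\mathcal P_p(F)$ is complete, by
weak compactness of the probability measures on $F$. -/

/-- Countable saturation: along a non-principal ultrafilter, countably many properties that hold
almost surely hold simultaneously along an index tending to infinity. -/
theorem Ultrafilter.exists_tendsto_atTop_eventually {ω : Ultrafilter ℕ} (hω : ∀ n : ℕ, ω ≠ pure n)
    {P : ℕ → ℕ → Prop} (h : ∀ n, ∀ᶠ i in (ω : Filter ℕ), P n i) :
    ∃ N : ℕ → ℕ, Tendsto N ω atTop ∧ ∀ᶠ i in (ω : Filter ℕ), P (N i) i := by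
  classical
  have hat : (ω : Filter ℕ) ≤ atTop := by
    rw [← Nat.cofinite_eq_atTop]
    exact ω.le_cofinite_or_eq_pure.resolve_right fun ⟨n, hn⟩ => hω n hn
  -- The largest $n\le i$ with `P n i`. The cap $n\le i$ costs nothing, since a non-principal
  -- $\omega$ contains every tail. The default value of the search is 0, so `h 0` is what guarantees
  -- that `P` holds at the value found.
  refine ⟨fun i => Nat.findGreatest (fun n => P n i) i, ?_, ?_⟩
  · refine tendsto_atTop.2 fun n => ?_
    filter_upwards [h n, hat (eventually_ge_atTop n)] with i hi hn
    exact Nat.le_findGreatest hn hi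
  · filter_upwards [h 0] with i hi
    exact Nat.findGreatest_spec (P := fun n => P n i) (Nat.zero_le i) hi

/-! ### Distances and completeness in metric ultralimits -/

namespace Ultralimit

variable {X : ℕ → Type*} [∀ i, PseudoMetricSpace (X i)] {ω : Ultrafilter ℕ} {e : ∀ i, X i}

theorem surjective_st : Function.Surjective (st : LimitedSeq X ω e → Ultralimit X ω e) :=
  SeparationQuotient.surjective_mk

theorem tendsto_dist (x y : LimitedSeq X ω e) :
    Tendsto (fun i => dist (x.1 i) (y.1 i)) (ω : Filter ℕ) (𝓝 (dist (st x) (st y))) :=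
  tendsto_stDist x y

theorem dist_st_le {x y : LimitedSeq X ω e} {C : ℝ}
    (h : ∀ᶠ i in (ω : Filter ℕ), dist (x.1 i) (y.1 i) ≤ C) : dist (st x) (st y) ≤ C :=
  le_of_tendsto (tendsto_dist x y) h

theorem le_dist_st {x y : LimitedSeq X ω e} {C : ℝ}
    (h : ∀ᶠ i in (ω : Filter ℕ), C ≤ dist (x.1 i) (y.1 i)) : C ≤ dist (st x) (st y) :=
  ge_of_tendsto (tendsto_dist x y) h

theorem st_eq_st {x y : LimitedSeq X ω e}
    (h : ∀ᶠ i in (ω : Filter ℕ), x.1 i = y.1 i) : st x = st y := by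
  refine dist_le_zero.1 (dist_st_le ?_)
  filter_upwards [h] with i hi
  rw [hi, dist_self]

theorem isLimited_of_dist_le {x y : ∀ i, X i} (hx : IsLimited ω e x) {C : ℝ}
    (h : ∀ᶠ i in (ω : Filter ℕ), dist (x i) (y i) ≤ C) : IsLimited ω e y := by
  obtain ⟨D, hD⟩ := hx
  refine ⟨C + D, ?_⟩
  filter_upwards [h, hD] with i h1 h2
  exact (dist_triangle_left _ _ _).trans (add_le_add h1 h2)

/-- Pushdowns of internal sets are complete. -/
theorem isComplete_pushdown (hω : ∀ n : ℕ, ω ≠ pure n) (S : ∀ i, Set (X i)) :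
    IsComplete (pushdown S : Set (Ultralimit X ω e)) := by
  rw [← completeSpace_coe_iff_isComplete]
  refine Metric.complete_of_convergent_controlled_sequences (fun n => (1 / 2 : ℝ) ^ n)
    (fun n => by positivity) fun u hu => ?_
  choose x hxS hx using fun n => (u n).2
  -- Property `n` involves only the first `n + 1` representatives, so it holds almost surely.
  -- Saturation then gives an index `N i` tending to infinity, and the diagonal sequence `x (N i)`
  -- represents the limit.
  have hP : ∀ n, ∀ᶠ i in (ω : Filter ℕ), (x n).1 i ∈ S i ∧
      ∀ m ∈ Set.Iic n, dist ((x m).1 i) ((x n).1 i) < (1 / 2 : ℝ) ^ m := by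
    intro n
    refine (hxS n).and ((eventually_all_finite (Set.finite_Iic n)).2 fun m hm => ?_)
    refine (tendsto_dist (x m) (x n)).eventually_lt_const ?_
    rw [hx, hx]
    exact hu m m n le_rfl hm
  obtain ⟨N, hN, hNP⟩ := Ultrafilter.exists_tendsto_atTop_eventually hω hP
  have hd : ∀ n, ∀ᶠ i in (ω : Filter ℕ),
      dist ((x n).1 i) ((x (N i)).1 i) ≤ (1 / 2 : ℝ) ^ n := by
    intro n
    filter_upwards [hNP, hN.eventually_ge_atTop n] with i hi hn
    exact (hi.2 n hn).le
  let y : LimitedSeq X ω e := ⟨fun i => (x (N i)).1 i, isLimited_of_dist_le (x 0).2 (hd 0)⟩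
  refine ⟨⟨st y, y, hNP.mono fun i hi => hi.1, rfl⟩, ?_⟩
  refine tendsto_iff_dist_tendsto_zero.2 (squeeze_zero (fun _ => dist_nonneg) (fun n => ?_)
    (tendsto_pow_atTop_nhds_zero_of_lt_one (r := (1 / 2 : ℝ)) (by norm_num) (by norm_num)))
  rw [Subtype.dist_eq, ← hx]
  exact dist_st_le (hd n)

theorem completeSpace (hω : ∀ n : ℕ, ω ≠ pure n) : CompleteSpace (Ultralimit X ω e) := by
  rw [completeSpace_iff_isComplete_univ]
  convert isComplete_pushdown (e := e) hω (fun i => (Set.univ : Set (X i)))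
  refine (Set.eq_univ_of_forall fun u => ?_).symm
  obtain ⟨x, rfl⟩ := surjective_st u
  exact ⟨x, by simp, rfl⟩

end Ultralimit

/-- A map that is isometric along a dense family extends to an isometry. -/
theorem DenseRange.exists_isometry {I A B : Type*} [PseudoMetricSpace A] [MetricSpace B]
    [CompleteSpace B] {c : I → A} (hc : DenseRange c) (g : I → B)
    (h : ∀ a b, dist (g a) (g b) = dist (c a) (c b)) :
    ∃ f : A → B, Isometry f ∧ ∀ a, f (c a) = g a := by
  have hex : ∀ (x : A) (n : ℕ), ∃ a, dist x (c a) < 1 / ((n : ℝ) + 1) := fun x n =>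
    hc.exists_dist_lt x (by positivity)
  choose s hs using hex
  have hst : ∀ x, Tendsto (fun n => c (s x n)) atTop (𝓝 x) := fun x =>
    tendsto_iff_dist_tendsto_zero.2 (squeeze_zero (fun _ => dist_nonneg)
      (fun n => by rw [dist_comm]; exact (hs x n).le) tendsto_one_div_add_atTop_nhds_zero_nat)
  -- By `h`, the images of the approximating sequence have the same mutual distances as the sequence
  -- itself.
  have hcau : ∀ x, ∃ y, Tendsto (fun n => g (s x n)) atTop (𝓝 y) := by
    intro x
    refine cauchySeq_tendsto_of_complete ?_
    have := (hst x).cauchySeq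
    rw [Metric.cauchySeq_iff] at this ⊢
    simpa only [h] using this
  choose f hf using hcau
  refine ⟨f, Isometry.of_dist_eq fun x y => ?_, fun a => ?_⟩
  · refine tendsto_nhds_unique ((hf x).dist (hf y)) ?_
    simpa only [h] using (hst x).dist (hst y)
  · refine tendsto_nhds_unique (hf (c a)) (tendsto_iff_dist_tendsto_zero.2 ?_)
    simpa only [h] using tendsto_iff_dist_tendsto_zero.1 (hst (c a))

/-! ### Transport between Dirac clouds -/

section CloudWeight

variable {Y : Type*} {N : ℕ}

open Classical in
/-- The conditional probability of the index `j` given that the uniform cloud `x` takes the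
value `z`. -/
noncomputable def cloudWeight (x : Fin N → Y) (j : Fin N) (z : Y) : ℝ≥0∞ :=
  if z = x j then ((Finset.univ.filter fun l => x l = x j).card : ℝ≥0∞)⁻¹ else 0

theorem sum_cloudWeight (x : Fin N → Y) (l : Fin N) : ∑ j, cloudWeight x j (x l) = 1 := by
  classical
  have h : ∀ j, cloudWeight x j (x l) =
      if x j = x l then ((Finset.univ.filter fun k => x k = x l).card : ℝ≥0∞)⁻¹ else 0 := by
    intro j
    unfold cloudWeight
    by_cases hj : x j = x l
    · simp [hj]
    · simp [hj, Ne.symm hj]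
  simp_rw [h]
  rw [← Finset.sum_filter, Finset.sum_const, nsmul_eq_mul]
  refine ENNReal.mul_inv_cancel ?_ (ENNReal.natCast_ne_top _)
  simp only [ne_eq, Nat.cast_eq_zero, Finset.card_eq_zero]
  exact Finset.ne_empty_of_mem (a := l) (by simp)

variable [MeasurableSpace Y] [MeasurableSingletonClass Y]

theorem measurable_cloudWeight (x : Fin N → Y) (j : Fin N) : Measurable (cloudWeight x j) :=
  Measurable.ite (measurableSet_eq (a := x j)) measurable_const measurable_const

theorem lintegral_cloudWeight (x : Fin N → Y) (j : Fin N) :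
    ∫⁻ z, cloudWeight x j z ∂((N : ℝ≥0∞)⁻¹ • ∑ j, Measure.dirac (x j)) = (N : ℝ≥0∞)⁻¹ := by
  classical
  rw [lintegral_smul_measure, lintegral_finsetSum_measure]
  simp_rw [lintegral_dirac]
  unfold cloudWeight
  rw [← Finset.sum_filter, Finset.sum_const, nsmul_eq_mul, ENNReal.mul_inv_cancel ?_
    (ENNReal.natCast_ne_top _), smul_eq_mul, mul_one]
  simp only [ne_eq, Nat.cast_eq_zero, Finset.card_eq_zero]
  exact Finset.ne_empty_of_mem (a := j) (by simp)

theorem ae_mem_range_cloud (x : Fin N → Y) :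
    ∀ᵐ z ∂((N : ℝ≥0∞)⁻¹ • ∑ j, Measure.dirac (x j) : Measure Y), z ∈ Set.range x := by
  refine Measure.ae_smul_measure ?_ _
  rw [ae_iff, Measure.coe_finsetSum, Finset.sum_apply]
  exact Finset.sum_eq_zero fun j _ => by simp

end CloudWeight

/-- A plan `γ` between the clouds `x` and `y` yields a matrix with row sums $1/N$ and column sums
$1/M$, which then serves as a plan between `x'` and `y'`. Minkowski's inequality for `edist + ε`
turns the pointwise error into an additive one. -/
theorem wassersteinEDist_cloud_le {p : ℝ} (hp : 1 ≤ p) {Y Z : Type*} [MetricSpace Y]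
    [MeasurableSpace Y] [OpensMeasurableSpace Y] [MetricSpace Z] [MeasurableSpace Z]
    [OpensMeasurableSpace Z] {N M : ℕ} [NeZero N] {x : Fin N → Y} {y : Fin M → Y}
    {x' : Fin N → Z} {y' : Fin M → Z} {ε : ℝ≥0∞}
    (h : ∀ j k, edist (x' j) (y' k) ≤ edist (x j) (y k) + ε) :
    wassersteinEDist p ((N : ℝ≥0∞)⁻¹ • ∑ j, Measure.dirac (x' j))
        ((M : ℝ≥0∞)⁻¹ • ∑ k, Measure.dirac (y' k)) ≤
      wassersteinEDist p ((N : ℝ≥0∞)⁻¹ • ∑ j, Measure.dirac (x j))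
        ((M : ℝ≥0∞)⁻¹ • ∑ k, Measure.dirac (y k)) + ε := by
  have hp0 : 0 < p := zero_lt_one.trans_le hp
  conv_rhs => unfold wassersteinEDist
  simp only [ENNReal.iInf_add]
  refine le_iInf₂ fun γ hγ => ?_
  have hprob : IsProbabilityMeasure ((N : ℝ≥0∞)⁻¹ • ∑ j, Measure.dirac (x j)) := by
    refine ⟨?_⟩
    simp [ENNReal.inv_mul_cancel (Nat.cast_ne_zero.2 (NeZero.ne N)) (ENNReal.natCast_ne_top N)]
  have hγp := hγ.isProbabilityMeasure
  have hd := hγ.aemeasurable_edist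
  have hx : ∀ᵐ z ∂γ, z.1 ∈ Set.range x := by
    have := ae_mem_range_cloud x
    rw [← hγ.map_fst] at this
    exact ae_of_ae_map measurable_fst.aemeasurable this
  have hy : ∀ᵐ z ∂γ, z.2 ∈ Set.range y := by
    have := ae_mem_range_cloud y
    rw [← hγ.map_snd] at this
    exact ae_of_ae_map measurable_snd.aemeasurable this
  have hw : ∀ j, Measurable fun z : Y × Y => cloudWeight x j z.1 := fun j =>
    (measurable_cloudWeight x j).comp measurable_fst
  have hv : ∀ k, Measurable fun z : Y × Y => cloudWeight y k z.2 := fun k =>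
    (measurable_cloudWeight y k).comp measurable_snd
  have hwv : ∀ j k, Measurable fun z : Y × Y => cloudWeight x j z.1 * cloudWeight y k z.2 :=
    fun j k => (hw j).mul (hv k)
  -- The mass that `γ` moves from index `j` to index `k`. Points of a cloud may coincide while their
  -- primed counterparts do not, so the mass at a repeated point is shared equally among its
  -- indices.
  let a : Fin N → Fin M → ℝ≥0∞ := fun j k => ∫⁻ z, cloudWeight x j z.1 * cloudWeight y k z.2 ∂γ
  have ha1 : ∀ j, ∑ k, a j k = (N : ℝ≥0∞)⁻¹ := by
    intro j
    rw [← lintegral_finsetSum _ fun k _ => hwv j k, ← lintegral_cloudWeight x j,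
      ← hγ.map_fst, lintegral_map (measurable_cloudWeight x j) measurable_fst]
    refine lintegral_congr_ae ?_
    filter_upwards [hy] with z ⟨l, hl⟩
    rw [← Finset.mul_sum, ← hl, sum_cloudWeight, mul_one]
  have ha2 : ∀ k, ∑ j, a j k = (M : ℝ≥0∞)⁻¹ := by
    intro k
    rw [← lintegral_finsetSum _ fun j _ => hwv j k, ← lintegral_cloudWeight y k,
      ← hγ.map_snd, lintegral_map (measurable_cloudWeight y k) measurable_snd]
    refine lintegral_congr_ae ?_
    filter_upwards [hx] with z ⟨l, hl⟩
    rw [← Finset.sum_mul, ← hl, sum_cloudWeight, one_mul]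
  let π : Measure (Z × Z) := ∑ j, ∑ k, a j k • Measure.dirac (x' j, y' k)
  have hπ : IsCoupling ((N : ℝ≥0∞)⁻¹ • ∑ j, Measure.dirac (x' j))
      ((M : ℝ≥0∞)⁻¹ • ∑ k, Measure.dirac (y' k)) π := by
    constructor
    · simp only [π, Measure.map_finset_sum measurable_fst.aemeasurable, Measure.map_smul,
        Measure.map_dirac' measurable_fst, ← Finset.sum_smul, ha1, Finset.smul_sum]
    · simp only [π, Measure.map_finset_sum measurable_snd.aemeasurable, Measure.map_smul,
        Measure.map_dirac' measurable_snd]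
      rw [Finset.sum_comm]
      simp only [← Finset.sum_smul, ha2, Finset.smul_sum]
  refine (iInf₂_le π hπ).trans ?_
  have hcost : ∫⁻ z, edist z.1 z.2 ^ p ∂π ≤ ∫⁻ z, (edist z.1 z.2 + ε) ^ p ∂γ := by
    have h1 : ∫⁻ z, edist z.1 z.2 ^ p ∂π =
        ∑ j, ∑ k, ∫⁻ z, cloudWeight x j z.1 * cloudWeight y k z.2 *
          edist (x' j) (y' k) ^ p ∂γ := by
      simp only [π, lintegral_finsetSum_measure, lintegral_smul_measure, lintegral_dirac,
        smul_eq_mul, a]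
      refine Finset.sum_congr rfl fun j _ => Finset.sum_congr rfl fun k _ => ?_
      rw [lintegral_mul_const _ (hwv j k)]
    rw [h1]
    simp_rw [← lintegral_finsetSum _ fun k _ => (hwv _ k).mul_const _]
    rw [← lintegral_finsetSum _ fun j _ => Finset.measurable_sum _
      fun k _ => (hwv j k).mul_const _]
    refine lintegral_mono_ae ?_
    -- The weights vanish unless `z = (x j, y k)`, where the hypothesis on distances applies; summed
    -- over all indices they give 1.
    filter_upwards [hx, hy] with z ⟨l, hl⟩ ⟨m, hm⟩
    calc ∑ j, ∑ k, cloudWeight x j z.1 * cloudWeight y k z.2 * edist (x' j) (y' k) ^ p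
        ≤ ∑ j, ∑ k, cloudWeight x j z.1 * cloudWeight y k z.2 * (edist z.1 z.2 + ε) ^ p := by
          refine Finset.sum_le_sum fun j _ => Finset.sum_le_sum fun k _ => ?_
          by_cases h1 : z.1 = x j
          · by_cases h2 : z.2 = y k
            · rw [h1, h2]
              gcongr
              exact h j k
            · simp [cloudWeight, h2]
          · simp [cloudWeight, h1]
      _ = (edist z.1 z.2 + ε) ^ p := by
          simp_rw [← Finset.sum_mul, ← Finset.mul_sum]
          rw [← Finset.sum_mul, ← hl, ← hm, sum_cloudWeight, sum_cloudWeight, one_mul, one_mul]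
  calc transportCost p π ≤ (∫⁻ z, (edist z.1 z.2 + ε) ^ p ∂γ) ^ (1 / p) := by
        unfold transportCost
        gcongr
    _ ≤ (∫⁻ z, edist z.1 z.2 ^ p ∂γ) ^ (1 / p) + (∫⁻ _, ε ^ p ∂γ) ^ (1 / p) :=
        ENNReal.lintegral_Lp_add_le hd aemeasurable_const hp
    _ = transportCost p γ + ε := by
        rw [lintegral_const, measure_univ, mul_one, ← ENNReal.rpow_mul,
          mul_one_div_cancel hp0.ne', ENNReal.rpow_one, transportCost]

namespace WassersteinSpace

variable {p : ℝ} [hp : Fact (1 ≤ p)]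

theorem dist_diracCloud_le {Y Z : Type*} [MetricSpace Y]
    [MeasurableSpace Y] [OpensMeasurableSpace Y] [MetricSpace Z] [MeasurableSpace Z]
    [OpensMeasurableSpace Z] {N M : ℕ} [NeZero N] [NeZero M] {x : Fin N → Y} {y : Fin M → Y}
    {x' : Fin N → Z} {y' : Fin M → Z} {ε : ℝ} (hε : 0 ≤ ε)
    (h : ∀ j k, dist (x' j) (y' k) ≤ dist (x j) (y k) + ε) :
    dist (diracCloud p N x') (diracCloud p M y') ≤
      dist (diracCloud p N x) (diracCloud p M y) + ε := by
  rw [← ENNReal.ofReal_le_ofReal_iff (by positivity), ENNReal.ofReal_add dist_nonneg hε,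
    ← edist_dist, ← edist_dist]
  refine wassersteinEDist_cloud_le hp.out fun j k => ?_
  rw [edist_dist, edist_dist, ← ENNReal.ofReal_add dist_nonneg hε]
  exact ENNReal.ofReal_le_ofReal (h j k)

theorem dist_diracCloud_eq {Y Z : Type*} [MetricSpace Y]
    [MeasurableSpace Y] [OpensMeasurableSpace Y] [MetricSpace Z] [MeasurableSpace Z]
    [OpensMeasurableSpace Z] {N M : ℕ} [NeZero N] [NeZero M] {x : Fin N → Y} {y : Fin M → Y}
    {x' : Fin N → Z} {y' : Fin M → Z} (h : ∀ j k, dist (x' j) (y' k) = dist (x j) (y k)) :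
    dist (diracCloud p N x') (diracCloud p M y') =
      dist (diracCloud p N x) (diracCloud p M y) := by
  refine le_antisymm ?_ ?_
  · simpa using dist_diracCloud_le (p := p) le_rfl fun j k => by rw [h j k, add_zero]
  · simpa using dist_diracCloud_le (p := p) le_rfl fun j k => by rw [← h j k, add_zero]

theorem dist_diracCloud_dirac_le {Y : Type*} [PseudoMetricSpace Y] [MeasurableSpace Y]
    [OpensMeasurableSpace Y] {N : ℕ} [NeZero N] {x : Fin N → Y} {y : Y} {C : ℝ} (hC : 0 ≤ C)
    (h : ∀ j, dist (x j) y ≤ C) : dist (diracCloud p N x) (dirac p y) ≤ C := by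
  have hp0 : 0 < p := zero_lt_one.trans_le hp.out
  rw [← ENNReal.ofReal_le_ofReal_iff hC, ← edist_dist]
  refine (wassersteinEDist_dirac_le hp0 _ y).trans ?_
  rw [one_div, ENNReal.rpow_inv_le_iff hp0]
  change ∫⁻ z, edist z y ^ p ∂((N : ℝ≥0∞)⁻¹ • ∑ j, Measure.dirac (x j)) ≤ _
  rw [lintegral_smul_measure, lintegral_finsetSum_measure]
  calc (N : ℝ≥0∞)⁻¹ • ∑ j, ∫⁻ z, edist z y ^ p ∂Measure.dirac (x j)
      ≤ (N : ℝ≥0∞)⁻¹ • ∑ _j : Fin N, ENNReal.ofReal C ^ p := by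
        simp only [smul_eq_mul]
        gcongr with j _
        rw [lintegral_dirac' _ (measurable_edist_left.pow_const p), edist_dist]
        gcongr
        exact h j
    _ = ENNReal.ofReal C ^ p := by
        rw [Finset.sum_const, Finset.card_univ, Fintype.card_fin, nsmul_eq_mul, smul_eq_mul,
          ← mul_assoc, ENNReal.inv_mul_cancel (Nat.cast_ne_zero.2 (NeZero.ne N))
          (ENNReal.natCast_ne_top N), one_mul]

end WassersteinSpace

/-! ### Rounding of finitely supported probability vectors -/

/-- Each `j` is listed `m j` times. The values lie in an arbitrary commutative monoid so that `f`
may take values in measures. -/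
theorem Finset.exists_fin_map_of_sum_eq (s : Finset ℕ) (m : ℕ → ℕ) {N : ℕ}
    (h : ∑ j ∈ s, m j = N) :
    ∃ y : Fin N → ℕ, ∀ {A : Type _} [AddCommMonoid A] (f : ℕ → A),
      ∑ k, f (y k) = ∑ j ∈ s, m j • f j := by
  have hcard : Fintype.card ((j : s) × Fin (m j)) = N := by
    rw [Fintype.card_sigma, ← h, ← Finset.sum_coe_sort s m]
    simp
  let E := Fintype.equivFinOfCardEq hcard
  refine ⟨fun k => (E.symm k).1, fun f => ?_⟩
  rw [Equiv.sum_comp E.symm (fun a : (j : s) × Fin (m j) => f a.1), Fintype.sum_sigma,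
    ← Finset.sum_coe_sort s (fun j => m j • f j)]
  simp

/-- Rounding of a finitely supported probability vector to multiples of `1 / N`; the excess mass
is moved to `0`. -/
theorem exists_rounding {n : ℕ} {a : ℕ → ℝ≥0∞} (ha : ∑ j ∈ Finset.range (n + 1), a j = 1)
    (N : ℕ) [NeZero N] :
    ∃ b c : ℕ → ℝ≥0∞, (∀ j ∈ Finset.range (n + 1), b j + c j = a j) ∧
      (∀ j, c j ≤ (N : ℝ≥0∞)⁻¹) ∧
      ∃ y : Fin N → ℕ, ∀ {A : Type _} [AddCommMonoid A] [Module ℝ≥0∞ A] (f : ℕ → A),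
        (N : ℝ≥0∞)⁻¹ • ∑ k, f (y k) =
          (∑ j ∈ Finset.range (n + 1), b j • f j) +
            (∑ j ∈ Finset.range (n + 1), c j) • f 0 := by
  have hN0 : (N : ℝ≥0∞) ≠ 0 := Nat.cast_ne_zero.2 (NeZero.ne N)
  have hNt : (N : ℝ≥0∞) ≠ ∞ := ENNReal.natCast_ne_top N
  have hfin : ∀ j ∈ Finset.range (n + 1), a j ≠ ∞ := fun j hj =>
    ne_top_of_le_ne_top ENNReal.one_ne_top (ha ▸ Finset.single_le_sum (fun _ _ => zero_le) hj)
  let m : ℕ → ℕ := fun j => ⌊N * (a j).toReal⌋₊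
  let b : ℕ → ℝ≥0∞ := fun j => (N : ℝ≥0∞)⁻¹ * m j
  have hba : ∀ j ∈ Finset.range (n + 1), b j ≤ a j ∧ a j ≤ b j + (N : ℝ≥0∞)⁻¹ := by
    intro j hj
    have h1 : N * a j = ENNReal.ofReal (N * (a j).toReal) := by
      rw [ENNReal.ofReal_mul (by positivity), ENNReal.ofReal_natCast,
        ENNReal.ofReal_toReal (hfin j hj)]
    have h2 : (m j : ℝ≥0∞) ≤ N * a j := by
      rw [h1, ← ENNReal.ofReal_natCast]
      exact ENNReal.ofReal_le_ofReal (Nat.floor_le (by positivity))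
    have h3 : N * a j ≤ m j + 1 := by
      rw [h1, ← ENNReal.ofReal_natCast, ← ENNReal.ofReal_one,
        ← ENNReal.ofReal_add (by positivity) zero_le_one]
      exact ENNReal.ofReal_le_ofReal (Nat.lt_floor_add_one _).le
    have h4 : (N : ℝ≥0∞)⁻¹ * (N * a j) = a j := by
      rw [← mul_assoc, ENNReal.inv_mul_cancel hN0 hNt, one_mul]
    constructor
    · calc b j ≤ (N : ℝ≥0∞)⁻¹ * (N * a j) := mul_le_mul_right h2 _
        _ = a j := h4
    · calc a j = (N : ℝ≥0∞)⁻¹ * (N * a j) := h4.symm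
        _ ≤ (N : ℝ≥0∞)⁻¹ * (m j + 1) := mul_le_mul_right h3 _
        _ = b j + (N : ℝ≥0∞)⁻¹ := by rw [mul_add, mul_one]
  let c : ℕ → ℝ≥0∞ := fun j => if j ∈ Finset.range (n + 1) then a j - b j else 0
  have hbc : ∀ j ∈ Finset.range (n + 1), b j + c j = a j := by
    intro j hj
    simp only [c, if_pos hj]
    exact add_tsub_cancel_of_le (hba j hj).1
  have hsum : ∑ j ∈ Finset.range (n + 1), b j + ∑ j ∈ Finset.range (n + 1), c j = 1 := by
    rw [← Finset.sum_add_distrib, Finset.sum_congr rfl hbc, ha]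
  have hbsum : ∑ j ∈ Finset.range (n + 1), b j =
      (N : ℝ≥0∞)⁻¹ * (∑ j ∈ Finset.range (n + 1), m j : ℕ) := by
    rw [Nat.cast_sum, Finset.mul_sum]
  have hle : ∑ j ∈ Finset.range (n + 1), m j ≤ N := by
    have h1 : (N : ℝ≥0∞)⁻¹ * (∑ j ∈ Finset.range (n + 1), m j : ℕ) ≤ 1 := by
      rw [← hbsum, ← hsum]
      exact le_self_add
    rw [mul_comm, ← div_eq_mul_inv, ENNReal.div_le_iff hN0 hNt, one_mul] at h1
    exact_mod_cast h1
  obtain ⟨r, hr⟩ := Nat.exists_eq_add_of_le hle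
  have hcsum : ∑ j ∈ Finset.range (n + 1), c j = (N : ℝ≥0∞)⁻¹ * r := by
    have hb1 : ∑ j ∈ Finset.range (n + 1), b j ≠ ∞ :=
      ne_top_of_le_ne_top ENNReal.one_ne_top (hsum ▸ le_self_add)
    refine (ENNReal.add_right_inj hb1).1 ?_
    rw [hsum, hbsum, ← mul_add, ← Nat.cast_add, ← hr, ENNReal.inv_mul_cancel hN0 hNt]
  refine ⟨b, c, hbc, fun j => ?_, ?_⟩
  · by_cases hj : j ∈ Finset.range (n + 1)
    · simp only [c, if_pos hj]
      exact tsub_le_iff_left.2 (hba j hj).2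
    · simp only [c, if_neg hj, zero_le]
  -- The floors `m j` add up to `N - r`; `r` further copies of index 0 complete them to a list of
  -- length `N`.
  · obtain ⟨y, hy⟩ := Finset.exists_fin_map_of_sum_eq (Finset.range (n + 1))
      (fun j => m j + if j = 0 then r else 0) (N := N) (by
        rw [Finset.sum_add_distrib, Finset.sum_ite_eq' (Finset.range (n + 1)) 0]
        simp [hr])
    refine ⟨y, fun f => ?_⟩
    rw [hy, hcsum]
    simp only [add_smul, ite_smul, zero_smul, Finset.sum_add_distrib]
    rw [Finset.sum_ite_eq' (Finset.range (n + 1)) 0, if_pos (by simp), smul_add, Finset.smul_sum]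
    simp only [b, mul_smul, Nat.cast_smul_eq_nsmul]

/-! ### Approximation of measures by Dirac clouds -/

section Approximation

variable {p : ℝ} {Y : Type*} [MetricSpace Y] [MeasurableSpace Y]

theorem wassersteinEDist_map_le (hp : 0 < p) (μ : Measure Y) {T : Y → Y} (hT : Measurable T) :
    wassersteinEDist p μ (μ.map T) ≤ (∫⁻ z, edist z (T z) ^ p ∂μ) ^ (1 / p) := by
  have hm : Measurable fun z : Y => (z, T z) := measurable_id.prodMk hT
  have hc : IsCoupling μ (μ.map T) (μ.map fun z => (z, T z)) :=
    ⟨by rw [Measure.map_map measurable_fst hm]; exact Measure.map_id,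
      by rw [Measure.map_map measurable_snd hm]; rfl⟩
  refine (iInf₂_le _ hc).trans ?_
  unfold transportCost
  gcongr
  exact lintegral_map_le _ _

variable [OpensMeasurableSpace Y]

theorem map_nearestPt_eq_sum (μ : Measure Y) (e : ℕ → Y) (n : ℕ) :
    μ.map (SimpleFunc.nearestPt e n) = ∑ j ∈ Finset.range (n + 1),
      μ (SimpleFunc.nearestPtInd e n ⁻¹' {j}) • Measure.dirac (e j) := by
  ext s hs
  rw [Measure.map_apply (SimpleFunc.measurable _) hs, Measure.coe_finsetSum, Finset.sum_apply]
  have hcov : SimpleFunc.nearestPt e n ⁻¹' s = ⋃ j ∈ Finset.range (n + 1),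
      SimpleFunc.nearestPtInd e n ⁻¹' {j} ∩ {_z | e j ∈ s} := by
    ext z
    simp only [SimpleFunc.nearestPt, SimpleFunc.coe_map, Set.mem_preimage, Function.comp_apply,
      Finset.mem_range, Set.mem_iUnion, Set.mem_inter_iff, Set.mem_singleton_iff,
      Set.mem_ofPred_eq, exists_prop]
    constructor
    · intro h
      exact ⟨_, Nat.lt_succ_of_le (SimpleFunc.nearestPtInd_le e n z), rfl, h⟩
    · rintro ⟨j, -, rfl, h⟩
      exact h
  rw [hcov, measure_biUnion_finset]
  · refine Finset.sum_congr rfl fun j _ => ?_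
    by_cases h : e j ∈ s <;> simp [h]
  · intro i _ j _ hij
    refine Disjoint.mono Set.inter_subset_left Set.inter_subset_left ?_
    exact (Set.disjoint_singleton.2 hij).preimage _
  · exact fun j _ => (SimpleFunc.measurableSet_preimage _ _).inter (MeasurableSet.const _)

/-- The measure is first moved to the nearest of the points `e 0, …, e n`, which gives the first
term. The resulting masses are then rounded to multiples of $1/N$: each of the `n + 1` atoms sends
at most $1/N$ to `e 0`, over a distance at most `D`, which gives the second term. -/
theorem exists_cloud_wassersteinEDist_le (hp : 1 ≤ p) (μ : Measure Y) [IsProbabilityMeasure μ]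
    [μ.InnerRegular] (e : ℕ → Y) (n N : ℕ) [NeZero N] {D : ℝ≥0∞}
    (hD : ∀ j ∈ Finset.range (n + 1), edist (e j) (e 0) ≤ D) :
    ∃ y : Fin N → Y, wassersteinEDist p μ ((N : ℝ≥0∞)⁻¹ • ∑ k, Measure.dirac (y k)) ≤
      (∫⁻ z, edist z (SimpleFunc.nearestPt e n z) ^ p ∂μ) ^ (1 / p) +
        ((n + 1 : ℕ) * ((N : ℝ≥0∞)⁻¹ * D ^ p)) ^ (1 / p) := by
  have hp0 : 0 < p := zero_lt_one.trans_le hp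
  let a : ℕ → ℝ≥0∞ := fun j => μ (SimpleFunc.nearestPtInd e n ⁻¹' {j})
  have hmap : μ.map (SimpleFunc.nearestPt e n) =
      ∑ j ∈ Finset.range (n + 1), a j • Measure.dirac (e j) := map_nearestPt_eq_sum μ e n
  have hνp : IsProbabilityMeasure (μ.map (SimpleFunc.nearestPt e n)) :=
    Measure.isProbabilityMeasure_map (SimpleFunc.measurable _).aemeasurable
  have ha : ∑ j ∈ Finset.range (n + 1), a j = 1 := by
    have h1 := hνp.measure_univ
    rw [hmap, Measure.coe_finsetSum, Finset.sum_apply] at h1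
    simpa using h1
  have hat : ∀ j, a j ≠ ∞ := fun j => measure_ne_top _ _
  -- The triangle inequality through this intermediate measure requires its inner regularity.
  have hνr : (μ.map (SimpleFunc.nearestPt e n)).InnerRegular := by
    have : ∀ j, (a j • Measure.dirac (e j)).InnerRegular := fun j => by
      lift a j to NNReal using hat j with r
      infer_instance
    rw [hmap]
    exact Finset.sum_induction _ (fun m : Measure Y => m.InnerRegular)
      (fun _ _ _ _ => inferInstance) inferInstance fun j _ => this j
  obtain ⟨b, c, hbc, hc, y, hy⟩ := exists_rounding ha N
  refine ⟨fun k => e (y k), wassersteinEDist_triangle hp (ν := μ.map (SimpleFunc.nearestPt e n))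
    |>.trans (add_le_add (wassersteinEDist_map_le hp0 μ (SimpleFunc.measurable _)) ?_)⟩
  let π : Measure (Y × Y) := ∑ j ∈ Finset.range (n + 1),
    (b j • Measure.dirac (e j, e j) + c j • Measure.dirac (e j, e 0))
  have hπ : IsCoupling (μ.map (SimpleFunc.nearestPt e n))
      ((N : ℝ≥0∞)⁻¹ • ∑ k, Measure.dirac (e (y k))) π := by
    constructor
    · rw [hmap, Measure.map_finset_sum measurable_fst.aemeasurable]
      refine Finset.sum_congr rfl fun j hj => ?_
      rw [Measure.map_add _ _ measurable_fst, Measure.map_smul, Measure.map_smul,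
        Measure.map_dirac' measurable_fst, Measure.map_dirac' measurable_fst, ← add_smul, hbc j hj]
    · rw [hy (fun j => Measure.dirac (e j)), Measure.map_finset_sum measurable_snd.aemeasurable,
        Finset.sum_smul, ← Finset.sum_add_distrib]
      refine Finset.sum_congr rfl fun j hj => ?_
      rw [Measure.map_add _ _ measurable_snd, Measure.map_smul, Measure.map_smul,
        Measure.map_dirac' measurable_snd, Measure.map_dirac' measurable_snd]
  refine (iInf₂_le π hπ).trans ?_
  unfold transportCost
  gcongr
  simp only [π, lintegral_finsetSum_measure, lintegral_add_measure, lintegral_smul_measure,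
    lintegral_dirac, edist_self, ENNReal.zero_rpow_of_pos hp0, smul_eq_mul, mul_zero, zero_add]
  calc ∑ j ∈ Finset.range (n + 1), c j * edist (e j) (e 0) ^ p
      ≤ ∑ _j ∈ Finset.range (n + 1), (N : ℝ≥0∞)⁻¹ * D ^ p := by
        refine Finset.sum_le_sum fun j hj => ?_
        gcongr
        · exact hc j
        · exact hD j hj
    _ = (n + 1 : ℕ) * ((N : ℝ≥0∞)⁻¹ * D ^ p) := by
        rw [Finset.sum_const, Finset.card_range, nsmul_eq_mul]

theorem tendsto_rounding_error (hp : 0 < p) (n : ℕ) {D : ℝ≥0∞} (hD : D ≠ ∞) :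
    Tendsto (fun N : ℕ => ((n + 1 : ℕ) * (((N + 1 : ℕ) : ℝ≥0∞)⁻¹ * D ^ p)) ^ (1 / p)) atTop
      (𝓝 0) := by
  have h1 : Tendsto (fun N : ℕ => ((N + 1 : ℕ) : ℝ≥0∞)⁻¹) atTop (𝓝 0) :=
    (tendsto_add_atTop_iff_nat 1).2 ENNReal.tendsto_inv_nat_nhds_zero
  have h2 := ENNReal.Tendsto.mul_const (b := D ^ p) h1
    (Or.inr (ENNReal.rpow_ne_top_of_nonneg hp.le hD))
  have h3 := ENNReal.Tendsto.const_mul (a := ((n + 1 : ℕ) : ℝ≥0∞)) h2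
    (Or.inr (ENNReal.natCast_ne_top _))
  have h4 := h3.ennrpow_const (1 / p)
  simpa [ENNReal.zero_rpow_of_pos (inv_pos.2 hp)] using h4

namespace WassersteinSpace

/-- Dominated convergence: the measure is carried by the closure of a countable set, so the nearest
points converge almost everywhere, and the finite moment about `x₀` supplies the dominating
function. -/
theorem tendsto_lintegral_nearestPt (hp : 0 < p) (μ : WassersteinSpace p Y) :
    ∃ e : ℕ → Y, Tendsto
      (fun n => ∫⁻ z, edist z (SimpleFunc.nearestPt e n z) ^ p ∂μ.toMeasure) atTop (𝓝 0) := by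
  obtain ⟨x₀, hx₀⟩ := μ.finite_moment
  obtain ⟨S, ⟨c, hc, hSc⟩, hS⟩ := exists_separable_carrier μ.toMeasure
  obtain ⟨s, hs⟩ := (hc.insert x₀).exists_eq_range (Set.insert_nonempty _ _)
  -- With `e 0 = x₀`, the nearest point is never farther away than `x₀`.
  let e : ℕ → Y := fun n => Nat.casesOn n x₀ s
  have hmeas : ∀ n, Measurable fun z => edist z (SimpleFunc.nearestPt e n z) ^ p := fun n =>
    (SimpleFunc.measurable_bind (SimpleFunc.nearestPt e n) (fun b z => edist z b)
      fun b => measurable_edist_left).pow_const p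
  refine ⟨e, ?_⟩
  have := tendsto_lintegral_of_dominated_convergence (μ := μ.toMeasure) (f := fun _ => 0)
    (fun z => edist z x₀ ^ p) hmeas (fun n => ae_of_all _ fun z => ?_) hx₀.ne ?_
  · simpa using this
  · refine ENNReal.rpow_le_rpow ?_ hp.le
    rw [edist_comm, edist_comm z]
    exact SimpleFunc.edist_nearestPt_le e z (Nat.zero_le n)
  · filter_upwards [hS] with z hz
    have hz' : z ∈ closure (Set.range e) := by
      refine closure_mono (fun w hw => ?_) (hSc hz)
      obtain ⟨k, hk⟩ := hs ▸ Set.mem_insert_of_mem x₀ hw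
      exact ⟨k + 1, hk⟩
    have h1 : Tendsto (fun n => edist z (SimpleFunc.nearestPt e n z)) atTop (𝓝 0) := by
      simpa using (tendsto_const_nhds (x := z)).edist (SimpleFunc.tendsto_nearestPt hz')
    simpa [hp] using h1.ennrpow_const p

variable [hp : Fact (1 ≤ p)]

/-- Dirac clouds are dense in the Wasserstein space. -/
theorem exists_dist_diracCloud_lt (μ : WassersteinSpace p Y) {ε : ℝ} (hε : 0 < ε) :
    ∃ (N : ℕ) (y : Fin (N + 1) → Y), dist μ (diracCloud p (N + 1) y) < ε := by
  have hp0 : 0 < p := zero_lt_one.trans_le hp.out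
  obtain ⟨e, he⟩ := tendsto_lintegral_nearestPt hp0 μ
  have hhalf : 0 < ENNReal.ofReal (ε / 2) := ENNReal.ofReal_pos.2 (half_pos hε)
  have he' := he.ennrpow_const (1 / p)
  rw [ENNReal.zero_rpow_of_pos (one_div_pos.2 hp0)] at he'
  obtain ⟨n, hn⟩ := (he'.eventually_lt_const hhalf).exists
  let D : ℝ≥0∞ := (Finset.range (n + 1)).sup fun j => edist (e j) (e 0)
  have hD : D ≠ ∞ := by
    refine ((Finset.sup_lt_iff ENNReal.zero_lt_top).2 fun j _ => ?_).ne
    exact edist_lt_top _ _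
  obtain ⟨N, hN⟩ := ((tendsto_rounding_error hp0 n hD).eventually_lt_const hhalf).exists
  obtain ⟨y, hy⟩ := exists_cloud_wassersteinEDist_le hp.out μ.toMeasure e n (N + 1) (D := D)
    fun j hj => Finset.le_sup (f := fun j => edist (e j) (e 0)) hj
  refine ⟨N, y, ?_⟩
  rw [← ENNReal.ofReal_lt_ofReal_iff hε, ← edist_dist]
  refine hy.trans_lt ((ENNReal.add_lt_add hn hN).trans_eq ?_)
  rw [← ENNReal.ofReal_add (half_pos hε).le (half_pos hε).le, add_halves]

/-- The size of an approximating Dirac cloud can be chosen uniformly over all measures on spaces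
with a given diameter that are covered by a given number of balls. -/
theorem exists_size_dist_diracCloud_lt (k : ℕ) (D : ℝ) {ε : ℝ} (hε : 0 < ε) :
    ∃ N : ℕ, ∀ {Z : Type _} [MetricSpace Z] [MeasurableSpace Z] [OpensMeasurableSpace Z]
      (μ : WassersteinSpace p Z) (t : Finset Z), t.card ≤ k → (∀ z w : Z, dist z w ≤ D) →
      (∀ z : Z, ∃ x ∈ t, dist z x ≤ ε / 2) →
      ∃ y : Fin (N + 1) → Z, dist μ (diracCloud p (N + 1) y) < ε := by
  have hp0 : 0 < p := zero_lt_one.trans_le hp.out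
  have hhalf : 0 < ENNReal.ofReal (ε / 2) := ENNReal.ofReal_pos.2 (half_pos hε)
  obtain ⟨N, hN⟩ := ((tendsto_rounding_error hp0 k (D := ENNReal.ofReal D)
    ENNReal.ofReal_ne_top).eventually_lt_const hhalf).exists
  refine ⟨N, fun μ t ht hD hcov => ?_⟩
  obtain ⟨z₀, -⟩ := μ.finite_moment
  -- The net as a sequence, padded with `z₀`. Since `t.card ≤ k`, the terms of index at most `k`
  -- exhaust it, so the bounds depend on `k` and `D` only.
  let e : ℕ → _ := fun j => t.toList.getD j z₀
  have he : ∀ z, edist z (SimpleFunc.nearestPt e k z) ≤ ENNReal.ofReal (ε / 2) := by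
    intro z
    obtain ⟨x, hx, hzx⟩ := hcov z
    obtain ⟨j, hj, hjx⟩ := List.mem_iff_getElem.1 (Finset.mem_toList.2 hx)
    have hjk : j ≤ k := (hj.le.trans (Finset.length_toList t).le).trans ht
    rw [edist_comm]
    refine (SimpleFunc.edist_nearestPt_le e z hjk).trans ?_
    have : e j = x := (List.getD_eq_getElem _ _ hj).trans hjx
    rw [this, edist_comm, edist_dist]
    exact ENNReal.ofReal_le_ofReal hzx
  obtain ⟨y, hy⟩ := exists_cloud_wassersteinEDist_le hp.out μ.toMeasure e k (N + 1)
    (D := ENNReal.ofReal D) fun j _ => by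
      rw [edist_dist]
      exact ENNReal.ofReal_le_ofReal (hD _ _)
  refine ⟨y, ?_⟩
  rw [← ENNReal.ofReal_lt_ofReal_iff hε, ← edist_dist]
  -- The strict inequality comes from the rounding term alone; adding the other one requires it to
  -- be finite, which is the first remaining goal.
  refine hy.trans_lt ((ENNReal.add_lt_add_of_le_of_lt ?_ ?_ hN).trans_eq
    (b := ENNReal.ofReal (ε / 2) + ENNReal.ofReal (ε / 2)) ?_)
  · refine ENNReal.rpow_ne_top_of_nonneg (by positivity) (ne_top_of_le_ne_top
      (b := ENNReal.ofReal (ε / 2) ^ p) (by finiteness) ?_)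
    refine (lintegral_mono fun z => ENNReal.rpow_le_rpow (he z) hp0.le).trans_eq ?_
    rw [lintegral_const, measure_univ, mul_one]
  · rw [one_div, ENNReal.rpow_inv_le_iff hp0]
    refine (lintegral_mono fun z => ENNReal.rpow_le_rpow (he z) hp0.le).trans_eq ?_
    rw [lintegral_const, measure_univ, mul_one]
  · rw [← ENNReal.ofReal_add (half_pos hε).le (half_pos hε).le, add_halves]

end WassersteinSpace

end Approximation

/-! ### Completeness of the Wasserstein space over a compact space -/

namespace WassersteinSpace

variable {p : ℝ} {K : Type*} [MetricSpace K] [CompactSpace K]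
  [MeasurableSpace K] [BorelSpace K]

/-- The transport cost is continuous in the plan over a compact space. -/
theorem continuous_lintegral_edist_rpow (hp0 : 0 ≤ p) :
    Continuous fun γ : ProbabilityMeasure (K × K) =>
      ∫⁻ z, edist z.1 z.2 ^ p ∂(γ : Measure (K × K)) := by
  have hf : Continuous fun z : K × K => nndist z.1 z.2 ^ p :=
    (NNReal.continuous_rpow_const hp0).comp (continuous_fst.nndist continuous_snd)
  have := ProbabilityMeasure.continuous_lintegral_continuousMap
    (⟨fun z : K × K => nndist z.1 z.2 ^ p, hf⟩ : C(K × K, NNReal))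
  refine this.congr fun γ => lintegral_congr fun z => ?_
  rw [edist_nndist]
  exact ENNReal.coe_rpow_of_nonneg _ hp0

variable [hp : Fact (1 ≤ p)]

/-- A probability measure on a compact metric space, as a point of the Wasserstein space. -/
def ofProbabilityMeasure (p : ℝ) [hp : Fact (1 ≤ p)]
    (μ : ProbabilityMeasure K) :
    WassersteinSpace p K where
  toMeasure := μ
  isProbabilityMeasure := inferInstance
  innerRegular := inferInstance
  finite_moment := by
    have hp0 : 0 ≤ p := zero_le_one.trans hp.out
    obtain ⟨x₀⟩ := μ.nonempty
    refine ⟨x₀, (lintegral_mono fun z => ENNReal.rpow_le_rpow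
      (Metric.edist_le_ediam_of_mem (Set.mem_univ z) (Set.mem_univ x₀)) hp0).trans_lt ?_⟩
    rw [lintegral_const, measure_univ, mul_one]
    exact ENNReal.rpow_lt_top_of_nonneg hp0 isCompact_univ.isBounded.ediam_ne_top

/-- Probability measures on `K` and plans on `K × K` form weakly compact spaces. A weak limit `μ` of
the sequence is its $W_p$ limit: near-optimal plans from `u n` to `u m` have a weak limit in `m`,
which couples `u n` with `μ`, and its cost is controlled because the cost function is continuous on
compact `K × K`. -/
instance completeSpace : CompleteSpace (WassersteinSpace p K) := by
  have hp0 : 0 < p := zero_lt_one.trans_le hp.out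
  have hB : Tendsto (fun n : ℕ => (1 / 2 : ℝ) ^ n) atTop (𝓝 0) :=
    tendsto_pow_atTop_nhds_zero_of_lt_one (by norm_num) (by norm_num)
  refine Metric.complete_of_convergent_controlled_sequences (fun n => (1 / 2 : ℝ) ^ n)
    (fun n => by positivity) fun u hu => ?_
  let U : Ultrafilter ℕ := hyperfilter ℕ
  have hU : (U : Filter ℕ) ≤ atTop := Nat.hyperfilter_le_atTop
  let ν : ℕ → ProbabilityMeasure K := fun m => ⟨(u m).toMeasure, (u m).isProbabilityMeasure⟩
  obtain ⟨μ, -, hμ⟩ := isCompact_univ.ultrafilter_le_nhds (U.map ν) (by simp)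
  have hμ : Tendsto ν U (𝓝 μ) := hμ
  refine ⟨ofProbabilityMeasure p μ, tendsto_iff_dist_tendsto_zero.2
    (squeeze_zero (fun _ => dist_nonneg) (fun n => ?_) hB)⟩
  have hpos : (0 : ℝ) ≤ (1 / 2) ^ n := by positivity
  have hγ : ∀ m, ∃ γ : ProbabilityMeasure (K × K), n ≤ m →
      IsCoupling (u n).toMeasure (u m).toMeasure γ ∧
      transportCost p (γ : Measure (K × K)) ≤ ENNReal.ofReal ((1 / 2) ^ n) := by
    intro m
    by_cases hm : n ≤ m
    · have h1 : edist (u n) (u m) < ENNReal.ofReal ((1 / 2) ^ n) := by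
        rw [edist_dist, ENNReal.ofReal_lt_ofReal_iff (by positivity)]
        exact hu n n m le_rfl hm
      rw [edist_def, wassersteinEDist] at h1
      simp only [iInf_lt_iff] at h1
      obtain ⟨γ, hγ, hlt⟩ := h1
      exact ⟨⟨γ, hγ.isProbabilityMeasure⟩, fun _ => ⟨hγ, hlt.le⟩⟩
    -- For `m < n` any plan will do, as these indices are negligible for `U`.
    · obtain ⟨x⟩ := μ.nonempty
      exact ⟨⟨Measure.dirac (x, x), inferInstance⟩, fun h => absurd h hm⟩
  choose γ hγ using hγ
  have hev : ∀ᶠ m in (U : Filter ℕ), n ≤ m := hU (eventually_ge_atTop n)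
  obtain ⟨γ', -, hγ'⟩ := isCompact_univ.ultrafilter_le_nhds (U.map γ) (by simp)
  have hγ' : Tendsto γ U (𝓝 γ') := hγ'
  have hfst : γ'.map measurable_fst.aemeasurable = ν n := by
    refine tendsto_nhds_unique
      (((ProbabilityMeasure.continuous_map continuous_fst).tendsto γ').comp hγ') ?_
    refine tendsto_const_nhds.congr' ?_
    filter_upwards [hev] with m hm
    exact Subtype.ext (hγ m hm).1.map_fst.symm
  have hsnd : γ'.map measurable_snd.aemeasurable = μ := by
    refine tendsto_nhds_unique
      (((ProbabilityMeasure.continuous_map continuous_snd).tendsto γ').comp hγ') ?_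
    refine hμ.congr' ?_
    filter_upwards [hev] with m hm
    exact Subtype.ext (hγ m hm).1.map_snd.symm
  have hc : IsCoupling (u n).toMeasure (μ : Measure K) γ' :=
    ⟨congrArg Subtype.val hfst, congrArg Subtype.val hsnd⟩
  have hcost : transportCost p (γ' : Measure (K × K)) ≤ ENNReal.ofReal ((1 / 2) ^ n) := by
    rw [transportCost, one_div, ENNReal.rpow_inv_le_iff hp0]
    refine le_of_tendsto (((continuous_lintegral_edist_rpow hp0.le).tendsto γ').comp hγ') ?_
    filter_upwards [hev] with m hm
    have := (hγ m hm).2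
    rwa [transportCost, one_div, ENNReal.rpow_inv_le_iff hp0] at this
  rw [← ENNReal.ofReal_le_ofReal_iff hpos, ← edist_dist]
  exact (iInf₂_le _ hc).trans hcost

end WassersteinSpace

/-! ### Measures on subspaces -/

namespace WassersteinSpace

variable {p : ℝ}

theorem ext_toMeasure {Y : Type*} [PseudoMetricSpace Y] [MeasurableSpace Y]
    {μ ν : WassersteinSpace p Y} (h : μ.toMeasure = ν.toMeasure) : μ = ν := by
  cases μ
  cases ν
  cases h
  rfl

variable [hp : Fact (1 ≤ p)]

theorem dist_dirac_dirac_le {Y : Type*} [PseudoMetricSpace Y] [MeasurableSpace Y]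
    [OpensMeasurableSpace Y] (x y : Y) : dist (dirac p x) (dirac p y) ≤ dist x y := by
  have h : dirac p x = diracCloud p 1 fun _ => x :=
    ext_toMeasure (by simp [dirac, diracCloud])
  rw [h]
  exact dist_diracCloud_dirac_le dist_nonneg fun _ => le_rfl

variable {Y : Type*} [MetricSpace Y] [MeasurableSpace Y]

theorem denseRange_diracCloud [OpensMeasurableSpace Y] :
    DenseRange fun c : (N : ℕ) × (Fin (N + 1) → Y) => diracCloud p (c.1 + 1) c.2 := by
  refine Metric.denseRange_iff.2 fun μ ε hε => ?_
  obtain ⟨N, y, hy⟩ := exists_dist_diracCloud_lt μ hε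
  exact ⟨⟨N, y⟩, hy⟩

variable [BorelSpace Y] {S : Set Y}

theorem ofSubspace_diracCloud {N : ℕ} [NeZero N] (y : Fin N → S) :
    ofSubspace S (diracCloud p N y) = diracCloud p N fun j => (y j : Y) := by
  refine ext_toMeasure ?_
  change Measure.map Subtype.val ((N : ℝ≥0∞)⁻¹ • ∑ j, Measure.dirac (y j)) =
    (N : ℝ≥0∞)⁻¹ • ∑ j, Measure.dirac (y j : Y)
  rw [Measure.map_smul, Measure.map_finset_sum measurable_subtype_coe.aemeasurable]
  simp only [Measure.map_dirac' measurable_subtype_coe]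

theorem ofSubspace_dirac (y : S) : ofSubspace S (dirac p y) = dirac p (y : Y) :=
  ext_toMeasure (Measure.map_dirac' measurable_subtype_coe y)

theorem diracCloud_mem_supportedOn {N : ℕ} [NeZero N] {y : Fin N → Y} (hy : ∀ j, y j ∈ S) :
    diracCloud p N y ∈ supportedOn p S :=
  ⟨diracCloud p N fun j => ⟨y j, hy j⟩, ofSubspace_diracCloud _⟩

theorem edist_ofSubspace_le (μ ν : WassersteinSpace p S) :
    edist (ofSubspace S μ) (ofSubspace S ν) ≤ edist μ ν := by
  have hp0 : 0 < p := zero_lt_one.trans_le hp.out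
  rw [edist_def, edist_def]
  refine le_iInf₂ fun γ hγ => ?_
  have hm : Measurable (Prod.map (Subtype.val : S → Y) (Subtype.val : S → Y)) :=
    measurable_subtype_coe.prodMap measurable_subtype_coe
  have hc : IsCoupling (ofSubspace S μ).toMeasure (ofSubspace S ν).toMeasure
      (γ.map (Prod.map Subtype.val Subtype.val)) := by
    constructor
    · change _ = μ.toMeasure.map Subtype.val
      rw [← hγ.map_fst, Measure.map_map measurable_fst hm,
        Measure.map_map measurable_subtype_coe measurable_fst]
      rfl
    · change _ = ν.toMeasure.map Subtype.val
      rw [← hγ.map_snd, Measure.map_map measurable_snd hm,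
        Measure.map_map measurable_subtype_coe measurable_snd]
      rfl
  refine (iInf₂_le _ hc).trans (ENNReal.rpow_le_rpow (lintegral_map_le _ _) (by positivity))

/-- `S` need not be measurable, so a plan on `Y × Y` is not simply restricted to `S × S`. Instead,
the pushforward is continuous and preserves distances between clouds, which are dense. -/
theorem isometry_ofSubspace : Isometry (ofSubspace (p := p) S) := by
  have hcont : Continuous (ofSubspace (p := p) S) :=
    (LipschitzWith.of_edist_le edist_ofSubspace_le).continuous
  refine Isometry.of_dist_eq fun μ ν => ?_
  refine denseRange_diracCloud.induction_on₂
    (p := fun μ ν => dist (ofSubspace S μ) (ofSubspace S ν) = dist μ ν)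
    (isClosed_eq ((hcont.comp continuous_fst).dist (hcont.comp continuous_snd))
      (continuous_fst.dist continuous_snd)) (fun a b => ?_) μ ν
  rw [ofSubspace_diracCloud, ofSubspace_diracCloud]
  exact dist_diracCloud_eq fun j k => rfl

theorem dist_ofSubspace (μ ν : WassersteinSpace p S) :
    dist (ofSubspace S μ) (ofSubspace S ν) = dist μ ν :=
  isometry_ofSubspace.dist_eq μ ν

end WassersteinSpace

/-! ### Boundedness and total boundedness of internal sets -/

section Pushdown

namespace Ultralimit

variable {X : ℕ → Type*} [∀ i, PseudoMetricSpace (X i)] {e : ∀ i, X i} {ω : Ultrafilter ℕ}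
  {F : Set (Ultralimit X ω e)} {Fi : ∀ i, Set (X i)}

/-- Internal sets that consist of limited points are uniformly bounded. -/
theorem exists_forall_dist_le (hω : ∀ n : ℕ, ω ≠ pure n)
    (hlim : ∀ x : ∀ i, X i, (∀ᶠ i in (ω : Filter ℕ), x i ∈ Fi i) → IsLimited ω e x) :
    ∃ C : ℝ, ∀ᶠ i in (ω : Filter ℕ), ∀ x ∈ Fi i, dist x (e i) ≤ C := by
  by_contra! hcon
  have hP : ∀ n : ℕ, ∀ᶠ i in (ω : Filter ℕ), ∃ x ∈ Fi i, (n : ℝ) < dist x (e i) :=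
    fun n => hcon n
  -- Without a uniform bound, points of `Fi i` farther than `N i → ∞` from `e i` would form a
  -- sequence that is not limited.
  obtain ⟨N, hN, hNP⟩ := Ultrafilter.exists_tendsto_atTop_eventually hω hP
  have : ∀ i, ∃ x, (∃ x ∈ Fi i, (N i : ℝ) < dist x (e i)) → x ∈ Fi i ∧ (N i : ℝ) < dist x (e i) :=
    fun i => by
      by_cases h : ∃ x ∈ Fi i, (N i : ℝ) < dist x (e i)
      · exact ⟨h.choose, fun _ => h.choose_spec⟩
      · exact ⟨e i, fun h' => absurd h' h⟩
  choose x hx using this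
  obtain ⟨C, hC⟩ := hlim x (hNP.mono fun i hi => (hx i hi).1)
  obtain ⟨m, hm⟩ := exists_nat_gt C
  obtain ⟨i, h1, h2, h3⟩ := (hC.and (hNP.and (hN.eventually_ge_atTop m))).exists
  have h4 : (m : ℝ) ≤ N i := by exact_mod_cast h3
  linarith [(hx i h2).2]

/-- An internal set with compact pushdown is uniformly totally bounded. -/
theorem exists_finset_cover (hF : IsCompact F)
    (hlim : ∀ x : ∀ i, X i, (∀ᶠ i in (ω : Filter ℕ), x i ∈ Fi i) → IsLimited ω e x)
    (hst : pushdown Fi = F) {ε : ℝ} (hε : 0 < ε) :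
    ∃ k : ℕ, ∀ᶠ i in (ω : Filter ℕ), ∃ t : Finset (X i), (t : Set (X i)) ⊆ Fi i ∧ t.card ≤ k ∧
      Fi i ⊆ ⋃ x ∈ t, Metric.ball x ε := by
  classical
  obtain ⟨T, hTF, hT, hcov⟩ := hF.finite_cover_balls hε
  lift T to Finset (Ultralimit X ω e) using hT
  have hrep : ∀ y ∈ F, ∃ x : LimitedSeq X ω e, (∀ᶠ i in (ω : Filter ℕ), x.1 i ∈ Fi i) ∧
      st x = y := by
    rw [← hst]
    exact fun y hy => hy
  have : Nonempty (LimitedSeq X ω e) := ⟨⟨e, 0, by simp⟩⟩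
  choose! r hr hry using hrep
  -- The lifts of the net `T` of `F` are the centres. If they fail to cover, then by the ultrafilter
  -- property they fail almost surely; the uncovered points `z i` define a point of `F` at distance
  -- at least `ε` from all of `T`, whereas the balls around `T` are open and cover `F`.
  refine ⟨T.card, ?_⟩
  by_contra hcon
  rw [← Ultrafilter.eventually_not] at hcon
  have hall : ∀ᶠ i in (ω : Filter ℕ), ∀ y ∈ T, (r y).1 i ∈ Fi i :=
    (Filter.eventually_all_finset T).2 fun y hy => hr y (hTF hy)
  have hz : ∀ᶠ i in (ω : Filter ℕ), ∃ z ∈ Fi i, ∀ y ∈ T, ε ≤ dist z ((r y).1 i) := by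
    filter_upwards [hcon, hall] with i h1 h2
    by_contra! h3
    refine h1 ⟨T.image fun y => (r y).1 i, ?_, Finset.card_image_le, fun z hz => ?_⟩
    · intro z hz
      obtain ⟨y, hy, rfl⟩ := Finset.mem_image.1 (Finset.mem_coe.1 hz)
      exact h2 y hy
    · obtain ⟨y, hy, hd⟩ := h3 z hz
      exact Set.mem_biUnion (Finset.mem_image_of_mem _ hy) (Metric.mem_ball.2 hd)
  have : ∀ i, ∃ z, (∃ z ∈ Fi i, ∀ y ∈ T, ε ≤ dist z ((r y).1 i)) →
      z ∈ Fi i ∧ ∀ y ∈ T, ε ≤ dist z ((r y).1 i) := fun i => by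
    by_cases h : ∃ z ∈ Fi i, ∀ y ∈ T, ε ≤ dist z ((r y).1 i)
    · exact ⟨h.choose, fun _ => h.choose_spec⟩
    · exact ⟨e i, fun h' => absurd h' h⟩
  choose z hzspec using this
  have hzF : ∀ᶠ i in (ω : Filter ℕ), z i ∈ Fi i := hz.mono fun i hi => (hzspec i hi).1
  let z' : LimitedSeq X ω e := ⟨z, hlim z hzF⟩
  have hz'F : st z' ∈ F := hst ▸ ⟨z', hzF, rfl⟩
  obtain ⟨y, hy, hd⟩ := Set.mem_iUnion₂.1 (hcov hz'F)
  rw [Metric.mem_ball, ← hry y (hTF hy)] at hd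
  exact absurd hd (not_lt.2 (le_dist_st (hz.mono fun i hi => (hzspec i hi).2 y hy)))

end Ultralimit

end Pushdown

/-! ### The canonical embedding and its image -/

section CanonicalEmbedding

open WassersteinSpace

variable {X : ℕ → Type*} [∀ i, MetricSpace (X i)]
  {e : ∀ i, X i} {ω : Ultrafilter ℕ} {p : ℝ} [hp : Fact (1 ≤ p)]

theorem denseRange_diracCloud_st :
    DenseRange fun c : (N : ℕ) × (Fin (N + 1) → LimitedSeq X ω e) =>
      diracCloud p (c.1 + 1) fun j => Ultralimit.st (c.2 j) := by
  refine Metric.denseRange_iff.2 fun μ ε hε => ?_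
  obtain ⟨N, y, hy⟩ := exists_dist_diracCloud_lt μ hε
  choose x hx using fun j => Ultralimit.surjective_st (y j)
  refine ⟨⟨N, x⟩, ?_⟩
  simpa only [hx] using hy

variable [∀ i, MeasurableSpace (X i)] [∀ i, BorelSpace (X i)]

theorem isLimited_diracCloud {N : ℕ} [NeZero N] (x : Fin N → LimitedSeq X ω e) :
    IsLimited ω (fun i => dirac p (e i)) (fun i => diracCloud p N fun j => (x j).1 i) := by
  choose C hC using fun j => (x j).2
  refine ⟨∑ j, |C j|, ?_⟩
  filter_upwards [eventually_all.2 hC] with i hi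
  exact dist_diracCloud_dirac_le (by positivity) fun j => (hi j).trans ((le_abs_self _).trans
    (Finset.single_le_sum (f := fun j => |C j|) (fun _ _ => abs_nonneg _) (Finset.mem_univ j)))

/-- The class of a sequence of Dirac clouds in the ultralimit of the Wasserstein spaces. -/
noncomputable def stDiracCloud (p : ℝ) [Fact (1 ≤ p)] {N : ℕ} [NeZero N]
    (x : Fin N → LimitedSeq X ω e) : WassersteinUltralimit p ω e :=
  Ultralimit.st ⟨_, isLimited_diracCloud x⟩

/-- The finitely many cross distances are almost surely within $\varepsilon/2$ of their limits
simultaneously, and `dist_diracCloud_le` applies in both directions. -/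
theorem dist_stDiracCloud {N M : ℕ} [NeZero N] [NeZero M] (x : Fin N → LimitedSeq X ω e)
    (y : Fin M → LimitedSeq X ω e) :
    dist (stDiracCloud p x) (stDiracCloud p y) =
      dist (diracCloud p N fun j => Ultralimit.st (x j))
        (diracCloud p M fun k => Ultralimit.st (y k)) := by
  refine tendsto_nhds_unique (Ultralimit.tendsto_dist _ _) (Metric.tendsto_nhds.2 fun ε hε => ?_)
  have h : ∀ᶠ i in (ω : Filter ℕ), ∀ j k,
      dist (dist ((x j).1 i) ((y k).1 i)) (dist (Ultralimit.st (x j)) (Ultralimit.st (y k)))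
        < ε / 2 :=
    eventually_all.2 fun j => eventually_all.2 fun k =>
      Metric.tendsto_nhds.1 (Ultralimit.tendsto_dist (x j) (y k)) _ (half_pos hε)
  filter_upwards [h] with i hi
  refine lt_of_le_of_lt ?_ (half_lt_self hε)
  rw [Real.dist_eq, abs_sub_le_iff, sub_le_iff_le_add', sub_le_iff_le_add']
  have hi' : ∀ j k, _ := fun j k => abs_sub_le_iff.1 (hi j k).le
  exact ⟨dist_diracCloud_le (half_pos hε).le fun j k => by linarith [(hi' j k).1],
    dist_diracCloud_le (half_pos hε).le fun j k => by linarith [(hi' j k).2]⟩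

theorem IsCanonicalEmbedding.map_diracCloud_eq
    {ι : WassersteinSpace p (Ultralimit X ω e) → WassersteinUltralimit p ω e}
    (h : IsCanonicalEmbedding ι) {N : ℕ} [NeZero N] (x : Fin N → LimitedSeq X ω e) :
    ι (diracCloud p N fun j => Ultralimit.st (x j)) = stDiracCloud p x :=
  (h.map_diracCloud N x).2

theorem IsCanonicalEmbedding.unique
    {ι ι' : WassersteinSpace p (Ultralimit X ω e) → WassersteinUltralimit p ω e}
    (h : IsCanonicalEmbedding ι) (h' : IsCanonicalEmbedding ι') : ι' = ι := by
  refine denseRange_diracCloud_st.equalizer h'.isometry.continuous h.isometry.continuous ?_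
  funext c
  exact (h'.map_diracCloud_eq c.2).trans (h.map_diracCloud_eq c.2).symm

/-- Different tuples of sequences may represent the same cloud in $\hat X$; equality of distances on
the indexing family makes the map well defined as well as isometric. -/
theorem exists_isCanonicalEmbedding (hω : ∀ n : ℕ, ω ≠ pure n) :
    ∃ ι : WassersteinSpace p (Ultralimit X ω e) → WassersteinUltralimit p ω e,
      IsCanonicalEmbedding ι := by
  have := Ultralimit.completeSpace hω (e := fun i => dirac p (e i))
  obtain ⟨ι, hι, hc⟩ := (denseRange_diracCloud_st (p := p) (e := e) (ω := ω)).exists_isometry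
    (fun c => stDiracCloud p c.2) fun a b => dist_stDiracCloud a.2 b.2
  refine ⟨ι, hι, fun N hN x => ⟨isLimited_diracCloud x, ?_⟩⟩
  -- The dense family is indexed so that clouds have `N + 1` points, and `NeZero` excludes the empty
  -- one.
  obtain _ | N := N
  · exact absurd rfl hN.out
  · exact hc ⟨N, x⟩

variable {F : Set (Ultralimit X ω e)} {Fi : ∀ i, Set (X i)}

/-- The target is complete, hence closed, so it suffices to treat clouds, whose points lift from `F`
to the `Fi i`. -/
theorem IsCanonicalEmbedding.image_supportedOn_subset (hω : ∀ n : ℕ, ω ≠ pure n)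
    {ι : WassersteinSpace p (Ultralimit X ω e) → WassersteinUltralimit p ω e}
    (hι : IsCanonicalEmbedding ι) (hst : Ultralimit.pushdown Fi = F) :
    ι '' supportedOn p F ⊆ Ultralimit.pushdown fun i => supportedOn p (Fi i) := by
  rintro _ ⟨_, ⟨m, rfl⟩, rfl⟩
  have hclosed : IsClosed (Ultralimit.pushdown (ω := ω) (e := fun i => dirac p (e i))
      fun i => supportedOn p (Fi i)) := (Ultralimit.isComplete_pushdown hω _).isClosed
  refine denseRange_diracCloud.induction_on (p := fun m => ι (ofSubspace F m) ∈
    Ultralimit.pushdown fun i => supportedOn p (Fi i)) m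
    (hclosed.preimage (hι.isometry.continuous.comp isometry_ofSubspace.continuous)) ?_
  rintro ⟨N, y⟩
  have hy : ∀ j, (y j : Ultralimit X ω e) ∈ Ultralimit.pushdown Fi := fun j => by
    rw [hst]
    exact (y j).2
  choose x hx hxy using hy
  rw [ofSubspace_diracCloud]
  simp_rw [← hxy]
  rw [hι.map_diracCloud_eq]
  refine ⟨_, ?_, rfl⟩
  filter_upwards [eventually_all.2 hx] with i hi
  exact diracCloud_mem_supportedOn hi

/-- An isometric image of the complete space $\mathcal P_p(F)$ is complete, hence closed. -/
theorem IsCanonicalEmbedding.isClosed_image_supportedOn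
    {ι : WassersteinSpace p (Ultralimit X ω e) → WassersteinUltralimit p ω e}
    (hι : IsCanonicalEmbedding ι) (hF : IsCompact F) : IsClosed (ι '' supportedOn p F) := by
  have := isCompact_iff_compactSpace.1 hF
  rw [supportedOn, ← Set.range_comp]
  exact (hι.isometry.comp isometry_ofSubspace).isUniformInducing.isComplete_range.isClosed

theorem exists_size_diracCloud_approx (hω : ∀ n : ℕ, ω ≠ pure n) (hF : IsCompact F)
    (hlim : ∀ x : ∀ i, X i, (∀ᶠ i in (ω : Filter ℕ), x i ∈ Fi i) → IsLimited ω e x)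
    (hst : Ultralimit.pushdown Fi = F) {ε : ℝ} (hε : 0 < ε) :
    ∃ N : ℕ, ∀ᶠ i in (ω : Filter ℕ), ∀ μ ∈ supportedOn p (Fi i),
      ∃ y : Fin (N + 1) → X i, (∀ j, y j ∈ Fi i) ∧ dist μ (diracCloud p (N + 1) y) < ε := by
  classical
  obtain ⟨C, hC⟩ := Ultralimit.exists_forall_dist_le hω hlim
  obtain ⟨k, hk⟩ := Ultralimit.exists_finset_cover hF hlim hst (half_pos hε)
  obtain ⟨N, hN⟩ := exists_size_dist_diracCloud_lt (p := p) k (C + C) hε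
  refine ⟨N, ?_⟩
  filter_upwards [hC, hk] with i hCi ⟨t, htF, htk, hcov⟩
  rintro _ ⟨m, rfl⟩
  -- The approximation takes place inside the space `Fi i`, so the centres of the cover have to lie
  -- in `Fi i`.
  obtain ⟨y, hy⟩ := hN m (t.subtype (· ∈ Fi i))
    ((Finset.card_subtype _ _).trans_le ((Finset.card_filter_le _ _).trans htk))
    (fun z w => (dist_triangle_right (z : X i) w (e i)).trans
      (add_le_add (hCi z z.2) (hCi w w.2)))
    (fun z => by
      obtain ⟨x, hx, hzx⟩ := Set.mem_iUnion₂.1 (hcov z.2)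
      exact ⟨⟨x, htF hx⟩, Finset.mem_subtype.2 hx, (Metric.mem_ball.1 hzx).le⟩)
  refine ⟨fun j => y j, fun j => (y j).2, ?_⟩
  rw [← ofSubspace_diracCloud, dist_ofSubspace]
  exact hy

/-- The image is closed, so approximation within every `ε` suffices. Clouds with a fixed number of
points approximate almost all `μ i`; each coordinate is a sequence in the `Fi i`, hence limited with
class in `F`, and the cloud of these classes is the required measure. -/
theorem IsCanonicalEmbedding.pushdown_subset_image (hω : ∀ n : ℕ, ω ≠ pure n)
    {ι : WassersteinSpace p (Ultralimit X ω e) → WassersteinUltralimit p ω e}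
    (hι : IsCanonicalEmbedding ι) (hF : IsCompact F)
    (hlim : ∀ x : ∀ i, X i, (∀ᶠ i in (ω : Filter ℕ), x i ∈ Fi i) → IsLimited ω e x)
    (hst : Ultralimit.pushdown Fi = F) :
    (Ultralimit.pushdown fun i => supportedOn p (Fi i)) ⊆ ι '' supportedOn p F := by
  rintro _ ⟨μ, hμ, rfl⟩
  rw [← (hι.isClosed_image_supportedOn hF).closure_eq, Metric.mem_closure_iff]
  intro ε hε
  obtain ⟨N, hN⟩ := exists_size_diracCloud_approx (p := p) hω hF hlim hst (half_pos hε)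
  have hex : ∀ i, ∃ y : Fin (N + 1) → X i,
      (∃ y : Fin (N + 1) → X i,
        (∀ j, y j ∈ Fi i) ∧ dist (μ.1 i) (diracCloud p (N + 1) y) < ε / 2) →
      (∀ j, y j ∈ Fi i) ∧ dist (μ.1 i) (diracCloud p (N + 1) y) < ε / 2 := fun i => by
    by_cases h : ∃ y : Fin (N + 1) → X i,
        (∀ j, y j ∈ Fi i) ∧ dist (μ.1 i) (diracCloud p (N + 1) y) < ε / 2
    · exact ⟨h.choose, fun _ => h.choose_spec⟩
    · exact ⟨fun _ => e i, fun h' => absurd h' h⟩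
  choose y hy using hex
  have hyμ : ∀ᶠ i in (ω : Filter ℕ), (∀ j, y i j ∈ Fi i) ∧
      dist (μ.1 i) (diracCloud p (N + 1) (y i)) < ε / 2 := by
    filter_upwards [hN, hμ] with i h1 h2
    exact hy i (h1 _ h2)
  have hyF : ∀ j, ∀ᶠ i in (ω : Filter ℕ), y i j ∈ Fi i := fun j => hyμ.mono fun i hi => hi.1 j
  let x : Fin (N + 1) → LimitedSeq X ω e := fun j => ⟨fun i => y i j, hlim _ (hyF j)⟩
  refine ⟨ι (diracCloud p (N + 1) fun j => Ultralimit.st (x j)), ⟨_, ?_, rfl⟩, ?_⟩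
  · refine diracCloud_mem_supportedOn fun j => ?_
    rw [← hst]
    exact ⟨x j, hyF j, rfl⟩
  · rw [hι.map_diracCloud_eq]
    exact (Ultralimit.dist_st_le (hyμ.mono fun i hi => hi.2.le)).trans_lt (half_lt_self hε)

theorem isLimited_ofSubspace {f : ∀ i, Fi i} (hf : IsLimited ω e fun i => (f i : X i))
    {m : ∀ i, WassersteinSpace p (Fi i)} (hm : IsLimited ω (fun i => dirac p (f i)) m) :
    IsLimited ω (fun i => dirac p (e i)) fun i => ofSubspace (Fi i) (m i) := by
  have hf' : IsLimited ω (fun i => dirac p (e i)) fun i => dirac p (f i : X i) := by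
    obtain ⟨C, hC⟩ := hf
    exact ⟨C, hC.mono fun i hi => (dist_dirac_dirac_le _ _).trans hi⟩
  obtain ⟨C, hC⟩ := hm
  refine Ultralimit.isLimited_of_dist_le hf' (C := C) (hC.mono fun i hi => ?_)
  rwa [← ofSubspace_dirac, dist_ofSubspace, dist_comm]

/-- Inclusion preserves distances at every index, hence also in the limit, which gives both
well-definedness and isometry. For the range, measures carried by the `Fi i` are pulled back almost
surely, and they remain limited about the base points `f i` because `f` itself is limited. -/
theorem exists_isometry_ofSubspace (hω : ∀ n : ℕ, ω ≠ pure n) {f : ∀ i, Fi i}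
    (hf : IsLimited ω e fun i => (f i : X i)) :
    ∃ J : WassersteinUltralimit p ω f → WassersteinUltralimit p ω e, Isometry J ∧
      (∀ m : LimitedSeq (fun i => WassersteinSpace p (Fi i)) ω (fun i => dirac p (f i)),
        J (Ultralimit.st m) = Ultralimit.st ⟨_, isLimited_ofSubspace hf m.2⟩) ∧
      Set.range J = Ultralimit.pushdown fun i => supportedOn p (Fi i) := by
  have := Ultralimit.completeSpace hω (e := fun i => dirac p (e i))
  obtain ⟨J, hJ, hJst⟩ := (Ultralimit.surjective_st (ω := ω)
    (e := fun i => dirac p (f i))).denseRange.exists_isometry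
    (fun m => (Ultralimit.st ⟨_, isLimited_ofSubspace hf m.2⟩ : WassersteinUltralimit p ω e))
    fun a b => tendsto_nhds_unique (Ultralimit.tendsto_dist _ _)
      ((Ultralimit.tendsto_dist a b).congr fun i => (dist_ofSubspace _ _).symm)
  refine ⟨J, hJ, hJst, Set.Subset.antisymm ?_ ?_⟩
  · rintro _ ⟨u, rfl⟩
    obtain ⟨m, rfl⟩ := Ultralimit.surjective_st u
    rw [hJst]
    exact ⟨_, Eventually.of_forall fun i => ⟨m.1 i, rfl⟩, rfl⟩
  · rintro _ ⟨μ, hμ, rfl⟩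
    have hex : ∀ i, ∃ m : WassersteinSpace p (Fi i), μ.1 i ∈ supportedOn p (Fi i) →
        ofSubspace (Fi i) m = μ.1 i := fun i => by
      by_cases h : μ.1 i ∈ supportedOn p (Fi i)
      · exact ⟨h.choose, fun _ => h.choose_spec⟩
      · exact ⟨dirac p (f i), fun h' => absurd h' h⟩
    choose m hm using hex
    have hmμ : ∀ᶠ i in (ω : Filter ℕ), ofSubspace (Fi i) (m i) = μ.1 i := hμ.mono hm
    obtain ⟨C, hC⟩ := hf
    obtain ⟨D, hD⟩ := μ.2
    have hml : IsLimited ω (fun i => dirac p (f i)) m := by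
      refine ⟨D + C, ?_⟩
      filter_upwards [hmμ, hC, hD] with i h1 h2 h3
      rw [← dist_ofSubspace, h1, ofSubspace_dirac]
      refine (dist_triangle_right _ _ (dirac p (e i))).trans (add_le_add h3 ?_)
      exact (dist_dirac_dirac_le _ _).trans h2
    exact ⟨Ultralimit.st ⟨m, hml⟩, (hJst ⟨m, hml⟩).trans (Ultralimit.st_eq_st hmμ)⟩

end CanonicalEmbedding

/-! ### The proposition -/

theorem mainTheorem6 {X : ℕ → Type*} [∀ i, MetricSpace (X i)] [∀ i, MeasurableSpace (X i)]
    [∀ i, BorelSpace (X i)] (e : ∀ i, X i)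
    (ω : Ultrafilter ℕ) (hω : ∀ n : ℕ, ω ≠ pure n)
    (p : ℝ) [Fact (1 ≤ p)]
    (F : Set (Ultralimit X ω e)) (hF : IsCompact F)
    (Fi : ∀ i, Set (X i))
    (hlim : ∀ x : ∀ i, X i, (∀ᶠ i in (ω : Filter ℕ), x i ∈ Fi i) → IsLimited ω e x)
    (hst : Ultralimit.pushdown Fi = F) :
    (∃ k : ℝ → ℕ, ∀ ε : ℝ, 0 < ε → ∀ᶠ i in (ω : Filter ℕ),
      ∃ t : Finset (X i), (t : Set (X i)) ⊆ Fi i ∧ t.card ≤ k ε ∧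
        Fi i ⊆ ⋃ x ∈ t, Metric.ball x ε) ∧
    ∃ ι : WassersteinSpace p (Ultralimit X ω e) → WassersteinUltralimit p ω e,
      IsCanonicalEmbedding ι ∧
      (∀ ι', IsCanonicalEmbedding ι' → ι' = ι) ∧
      ι '' WassersteinSpace.supportedOn p F =
        Ultralimit.pushdown (fun i => WassersteinSpace.supportedOn p (Fi i)) ∧
      ∀ f : ∀ i, Fi i, ∃ J : WassersteinUltralimit p ω f → WassersteinUltralimit p ω e,
        Isometry J ∧
        (∀ m : LimitedSeq (fun i => WassersteinSpace p (Fi i)) ω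
            (fun i => WassersteinSpace.dirac p (f i)),
          ∃ h : IsLimited ω (fun i => WassersteinSpace.dirac p (e i))
              (fun i => WassersteinSpace.ofSubspace (Fi i) (m.1 i)),
            J (Ultralimit.st m) = Ultralimit.st ⟨_, h⟩) ∧
        Set.range J = ι '' WassersteinSpace.supportedOn p F := by
  refine ⟨?_, ?_⟩
  · have h : ∀ ε : ℝ, ∃ k : ℕ, 0 < ε → ∀ᶠ i in (ω : Filter ℕ),
        ∃ t : Finset (X i), (t : Set (X i)) ⊆ Fi i ∧ t.card ≤ k ∧
          Fi i ⊆ ⋃ x ∈ t, Metric.ball x ε := fun ε => by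
      by_cases hε : 0 < ε
      · obtain ⟨k, hk⟩ := Ultralimit.exists_finset_cover hF hlim hst hε
        exact ⟨k, fun _ => hk⟩
      · exact ⟨0, fun h => absurd h hε⟩
    choose k hk using h
    exact ⟨k, hk⟩
  · obtain ⟨ι, hι⟩ := exists_isCanonicalEmbedding (p := p) (e := e) hω
    have himage : ι '' WassersteinSpace.supportedOn p F =
        Ultralimit.pushdown (fun i => WassersteinSpace.supportedOn p (Fi i)) :=
      Set.Subset.antisymm (hι.image_supportedOn_subset hω hst)
        (hι.pushdown_subset_image hω hF hlim hst)
    refine ⟨ι, hι, fun ι' hι' => hι.unique hι', himage, fun f => ?_⟩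
    obtain ⟨J, hJ, hJst, hJr⟩ := exists_isometry_ofSubspace (p := p) hω
      (hlim (fun i => f i) (Eventually.of_forall fun i => (f i).2))
    exact ⟨J, hJ, fun m => ⟨_, hJst m⟩, hJr.trans himage.symm⟩
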